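/- Let $\omega_1>0$ and $\omega_3=i\tau$ with $\tau>0$, let $\Lambda=2\omega_1\mathbb Z+2\omega_3\mathbb Z$, let $\sigma(z)=z\prod_{l\in\Lambda\setminus\{0\}}\left(1-\frac zl\right)\exp\left(\frac zl+\frac{z^2}{2l^2}\right)$ be the Weierstrass sigma function of $\Lambda$, and put $\zeta=\sigma'/\sigma$, $\eta_1=\zeta(\omega_1)$, $h=e^{i\pi\omega_3/\omega_1}\in(0,1)$. Let $w\in\mathbb R$ satisfy $wN_1\neq\omega_1N_2$ for all integers $(N_1,N_2)\neq(0,0)$. Let $\alpha=-\alpha_0-2\nu\omega_3$ with $0\le\alpha_0<2\omega_1$, $0<\nu<1$, and let $\beta,\gamma,\kappa\in\mathbb C$ with $\beta\notin\Lambda$, $\kappa\ne0$. Put $$f_\gamma(z)=\kappa\,\frac{\sigma(z+\alpha+\beta)}{\sigma(z+\alpha)}\,e^{\gamma z},\qquad c_n=f_\gamma(wn)\quad(n\in\mathbb Z),\qquad \Delta_n=\det(c_{k-i})_{i,k=0}^{n-1},\quad \Delta_0=1,$$ and assume $\Delta_n\ne0$ for all $n$. Put $h_n=\Delta_{n+1}/\Delta_n$.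 Let $P_n$ (the elliptic polynomials) be the monic Laurent biorthogonal polynomials with these moments: $\Delta_nP_n(z)$ is the determinant of the $(n+1)\times(n+1)$ matrix with rows $(c_{-i},c_{1-i},\dots,c_{n-i})$, $i=0,\dots,n-1$, and last row $(1,z,\dots,z^n)$. Let $Q_n$ be their biorthogonal partners: $\Delta_nQ_n(z)$ is the same determinant with $c_{k-i}$ replaced by $c_{i-k}$. (For $\kappa=e^{\gamma\alpha}/\sigma(\beta)$ one has $c_n=e^{\gamma wn+\gamma\alpha}\frac{\sigma(wn+\alpha+\beta)}{\sigma(wn+\alpha)\sigma(\beta)}$; the polynomials do not depend on $\kappa$.) For an integer $j\ge1$ put $z_s=\exp\left(\frac{i\pi sw}{j\omega_1}\right)$, $s\in\mathbb Z$. For $m\in\mathbb Z$ define weights by $$A_{m+jk}=\frac{2\pi i\,R_0\,e^{-i\pi\alpha_0k/\omega_1}\,h^{-2\nu k}}{1-e^{-i\pi\beta/\omega_1}\,h^{-2k}}\quad(k\in\mathbb Z),\qquad A_s=0\ \text{ if } s\not\equiv m \pmod j,\qquad R_0=\frac{\kappa\,\sigma(\beta)}{2\omega_1}\,e^{\alpha\beta\eta_1/\omega_1}.$$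 (a) Suppose that $f=f_\gamma$ satisfies $f(z+2\omega_1j)=f(z)$ for all $z$. Then there is $m\in\mathbb Z$ with $j(\omega_1\gamma+\eta_1\beta)=i\pi m$, and for this $m$: $f$ is continuous on $\mathbb R$ and its Fourier coefficients are the weights, $\frac1T\int_0^Tf(x)e^{-2\pi isx/T}dx=A_s$ with $T=2j\omega_1$, for all $s\in\mathbb Z$; $\sum_s|A_s|<\infty$; the points $z_s$ are pairwise distinct and lie on the unit circle, and those with $A_s\ne0$ are dense in it; and $$\sum_{s=-\infty}^{\infty}A_s\,P_n(z_s)\,Q_{n'}(1/z_s)=h_n\,\delta_{nn'}\qquad(n,n'\ge0),$$ the series converging absolutely. (b) Let $\gamma$ be arbitrary, let $m\in\mathbb Z$, let $\chi$ be determined by $\omega_1(\gamma+\chi)+\eta_1\beta=i\pi m/j$, and put $q=e^{w\chi}$. Then $f_{\gamma+\chi}$ is $2\omega_1j$-periodic and continuous on $\mathbb R$, with Fourier coefficients $A_s$ as above; the polynomials $\tilde P_n,\tilde Q_n$ that belong to $\gamma+\chi$ instead of $\gamma$ are $\tilde P_n(z)=q^nP_n(z/q)$ and $\tilde Q_n(z)=q^{-n}Q_n(qz)$;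 $\sum_s|A_s|<\infty$; the points $z_s/q$ are pairwise distinct and lie on the circle $|z|=1/|q|$, and those with $A_s\ne0$ are dense in it; and $$\sum_{s=-\infty}^{\infty}A_s\,P_n(z_s/q)\,Q_{n'}(q/z_s)=h_n\,\delta_{nn'}\qquad(n,n'\ge0),$$ the series converging absolutely. -/

import Mathlib

noncomputable section

/-- The Weierstrass sigma function of the lattice of `L`,
`σ(z) = z ∏_{l ≠ 0} (1 - z / l) exp (z / l + z² / (2 l²))`.
The factor of `l = 0` is equal to `1` because `z / 0 = 0`. -/
def PeriodPair.weierstrassSigma (L : PeriodPair) (z : ℂ) : ℂ :=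
  z * ∏' l : L.lattice, (1 - z / (l : ℂ)) * Complex.exp (z / (l : ℂ) + z ^ 2 / (2 * (l : ℂ) ^ 2))

/-- The Weierstrass zeta function `ζ = σ' / σ`. -/
def PeriodPair.weierstrassZeta (L : PeriodPair) (z : ℂ) : ℂ :=
  deriv L.weierstrassSigma z / L.weierstrassSigma z

namespace EllipticLBP

/-- The elliptic function of the second kind `f(z) = κ σ(z + α + β) / σ(z + α) * exp (γ z)`. -/
def secondKind (L : PeriodPair) (κ α β γ z : ℂ) : ℂ :=
  κ * (L.weierstrassSigma (z + α + β) / L.weierstrassSigma (z + α)) * Complex.exp (γ * z)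

/-- The elliptic moments `c_n = f(w n)`, `n ∈ ℤ`. -/
def moment (L : PeriodPair) (κ α β γ : ℂ) (w : ℝ) (n : ℤ) : ℂ :=
  secondKind L κ α β γ ((w : ℂ) * (n : ℂ))

/-- The Toeplitz determinant `Δ_n = det (c_{k-i})_{i,k = 0..n-1}`; `Δ_0 = 1`. -/
def toeplitzDet (c : ℤ → ℂ) (n : ℕ) : ℂ :=
  Matrix.det (Matrix.of fun i k : Fin n => c ((k : ℤ) - (i : ℤ)))

/-- The normalization constants `h_n = Δ_{n+1} / Δ_n`. -/
def normConst (c : ℤ → ℂ) (n : ℕ) : ℂ :=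
  toeplitzDet c (n + 1) / toeplitzDet c n

/-- The monic Laurent biorthogonal polynomial `P_n` of the moments `c`: the determinant with
rows `(c_{-i}, c_{1-i}, …, c_{n-i})`, `i = 0..n-1`, and `(1, z, …, z^n)`, divided by `Δ_n`. -/
def lbp (c : ℤ → ℂ) (n : ℕ) : Polynomial ℂ :=
  Polynomial.C (toeplitzDet c n)⁻¹ *
    Matrix.det (Matrix.of fun i k : Fin (n + 1) =>
      if (i : ℕ) < n then Polynomial.C (c ((k : ℤ) - (i : ℤ))) else Polynomial.X ^ (k : ℕ))

/-- The biorthogonal partner `Q_n`: the determinant with rows `(c_i, c_{i-1}, …, c_{i-n})`,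
`i = 0..n-1`, and `(1, z, …, z^n)`, divided by `Δ_n`. -/
def lbpPartner (c : ℤ → ℂ) (n : ℕ) : Polynomial ℂ :=
  Polynomial.C (toeplitzDet c n)⁻¹ *
    Matrix.det (Matrix.of fun i k : Fin (n + 1) =>
      if (i : ℕ) < n then Polynomial.C (c ((i : ℤ) - (k : ℤ))) else Polynomial.X ^ (k : ℕ))

/-- The `n`-th Fourier coefficient `(1 / T) ∫₀ᵀ f(x) exp (-2 π i n x / T) dx`. -/
def fourierCoefficient (T : ℝ) (f : ℂ → ℂ) (n : ℤ) : ℂ :=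
  1 / (T : ℂ) * ∫ x in (0 : ℝ)..T,
    f (x : ℂ) * Complex.exp (-2 * Real.pi * Complex.I * (n : ℂ) * (x : ℂ) / (T : ℂ))

/-- The nodes `z_s = exp (i π s w / (j ω₁))`. -/
def node (ω₁ w : ℝ) (j : ℕ) (s : ℤ) : ℂ :=
  Complex.exp (Complex.I * Real.pi * (s : ℂ) * (w : ℂ) / ((j : ℂ) * (ω₁ : ℂ)))

/-- `h = exp (i π ω₃ / ω₁)` for `ω₃ = i τ`, a real number. -/
def nome (ω₁ τ : ℝ) : ℝ := Real.exp (-(Real.pi * τ / ω₁))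

/-- `R₀ = κ σ(β) / (2 ω₁) * exp (α β η₁ / ω₁)`, where `η₁ = ζ(ω₁)`. -/
def residueConst (L : PeriodPair) (ω₁ : ℝ) (κ α β : ℂ) : ℂ :=
  κ * L.weierstrassSigma β / (2 * (ω₁ : ℂ)) *
    Complex.exp (α * β * L.weierstrassZeta (ω₁ : ℂ) / (ω₁ : ℂ))

/-- The explicit weights: for `s = m + j k`,
`A_s = 2 π i R₀ exp (-i π α₀ k / ω₁) h^(-2 ν k) / (1 - exp (-i π β / ω₁) h^(-2 k))`,
and `A_s = 0` if `s ≢ m` modulo `j`; here `α = -α₀ - 2 ν i τ`. -/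
def weight (L : PeriodPair) (ω₁ τ α₀ ν : ℝ) (κ β : ℂ) (j : ℕ) (m s : ℤ) : ℂ :=
  if (j : ℤ) ∣ s - m then
    let k : ℤ := (s - m) / (j : ℤ)
    2 * Real.pi * Complex.I *
        residueConst L ω₁ κ (-(α₀ : ℂ) - 2 * (ν : ℂ) * ((τ : ℂ) * Complex.I)) β *
        Complex.exp (-(Complex.I * Real.pi * (α₀ : ℂ) * (k : ℂ) / (ω₁ : ℂ))) *
        ((nome ω₁ τ ^ (-2 * ν * (k : ℝ)) : ℝ) : ℂ) /
      (1 - Complex.exp (-(Complex.I * Real.pi * β / (ω₁ : ℂ))) *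
        ((nome ω₁ τ ^ (-2 * k) : ℝ) : ℂ))
  else 0

end EllipticLBP

end

/-! ### The Weierstrass sigma and zeta functions: product, partial fractions, quasi-periods. -/

noncomputable section

open Complex Filter Topology Metric

/-! Biorthogonality with respect to a discrete measure is formal once c_n = Σ A_s z_s^n holds for
every integer n. Pairing the determinant of P_n with z^(-i) replaces its last row by a row of
moments, which repeats row i when i < n and completes the determinant Δ_{n+1} when i = n
(`hasSum_lbp_mul_lbpPartner`).

The moment formula is the Fourier series of f at x = wn (`hasSum_weight_mul_node_zpow`). The
condition 0 < ν < 1 keeps the poles of f off the real line, so f is continuous there. If f also has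
period T = 2jω₁, absolute summability of its coefficients gives convergence at every point, and the
character of index s takes the value z_s^n at wn.

The coefficients come from residues. Multiplying f by exp(-2πisx/T) only changes γ, and a function
of the second kind is multiplied by a constant under each lattice translation. Cutting [0, T] into j
periods therefore leaves a geometric sum of j-th roots of unity, which vanishes unless s ≡ m mod j
(`fourierCoefficient_secondKind`). In the remaining case the integrand has period 2ω₁. Take a period
rectangle around its pole whose lower side lies on the real line: the upper side is its translate by
2ω₃ and contributes the same integral times the multiplier μ, so (1 - μ)∫f = 2πi Res
(`integral_secondKind`). The Legendre relation makes μ explicit. It and the quasi-periodicity of σ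
are derived here from the product.

Distinctness and density of the nodes express the incommensurability of w and ω₁. For general γ, the
factor exp(χz) makes f periodic and turns c_n into q^n c_n; this rescales the variable of the
polynomials and leaves Δ_n and h_n unchanged. -/

/-- The elementary factor `(1 - u) exp (u + u² / 2)` of genus two. -/
def elementaryFactor (u : ℂ) : ℂ := (1 - u) * exp (u + u ^ 2 / 2)

/-- The exponent is the Taylor polynomial of -log(1 - u) of degree two, so (1 - u)(1 + u) - 1 = -u².
This double zero makes the factor 1 + O(u³), which suffices for convergence over a lattice of rank
two. -/
lemma hasDerivAt_elementaryFactor (u : ℂ) :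
    HasDerivAt elementaryFactor (-u ^ 2 * exp (u + u ^ 2 / 2)) u := by
  have h1 : HasDerivAt (fun u : ℂ => 1 - u) (-1) u := by
    simpa using (hasDerivAt_id u).const_sub 1
  have h2 : HasDerivAt (fun u : ℂ => u + u ^ 2 / 2) (1 + u) u := by
    have := (hasDerivAt_id u).add (((hasDerivAt_id u).pow 2).div_const 2)
    convert! this using 1
    simp
  convert! h1.mul h2.cexp using 1
  ring

lemma differentiable_elementaryFactor : Differentiable ℂ elementaryFactor :=
  fun u => (hasDerivAt_elementaryFactor u).differentiableAt

lemma elementaryFactor_zero : elementaryFactor 0 = 1 := by simp [elementaryFactor]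

lemma elementaryFactor_ne_zero {u : ℂ} (hu : u ≠ 1) : elementaryFactor u ≠ 0 :=
  mul_ne_zero (sub_ne_zero.2 hu.symm) (exp_ne_zero _)

lemma norm_elementaryFactor_sub_one_le {u : ℂ} (hu : ‖u‖ ≤ 1) :
    ‖elementaryFactor u - 1‖ ≤ Real.exp 2 * ‖u‖ ^ 3 := by
  have key := (convex_closedBall (0 : ℂ) ‖u‖).norm_image_sub_le_of_norm_hasDerivWithin_le
    (f := elementaryFactor) (f' := fun u => -u ^ 2 * exp (u + u ^ 2 / 2))
    (C := Real.exp 2 * ‖u‖ ^ 2) (x := 0) (y := u)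
    (fun x _ => (hasDerivAt_elementaryFactor x).hasDerivWithinAt) (fun x hx => ?_)
    (by simp) (by simp)
  · rw [elementaryFactor_zero, sub_zero] at key
    linarith [show Real.exp 2 * ‖u‖ ^ 2 * ‖u‖ = Real.exp 2 * ‖u‖ ^ 3 by ring]
  · have hx : ‖x‖ ≤ ‖u‖ := by simpa using hx
    have hx1 : ‖x‖ ≤ 1 := hx.trans hu
    have h1 : (x + x ^ 2 / 2).re ≤ 2 := by
      refine (re_le_norm _).trans ((norm_add_le _ _).trans ?_)
      have : ‖x ^ 2 / 2‖ ≤ 1 := by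
        rw [norm_div, norm_pow, RCLike.norm_ofNat]
        nlinarith [norm_nonneg x]
      linarith
    rw [norm_mul, norm_neg, norm_pow, norm_exp, mul_comm]
    gcongr

namespace PeriodPair

variable (L : PeriodPair)

/-- The product `σ(z) / z`. -/
def sigmaProd (z : ℂ) : ℂ :=
  ∏' l : L.lattice, (1 - z / (l : ℂ)) * exp (z / (l : ℂ) + z ^ 2 / (2 * (l : ℂ) ^ 2))

lemma weierstrassSigma_eq (z : ℂ) : L.weierstrassSigma z = z * L.sigmaProd z := rfl

lemma sigmaFactor_eq (l z : ℂ) :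
    (1 - z / l) * exp (z / l + z ^ 2 / (2 * l ^ 2)) = elementaryFactor (z / l) := by
  rw [elementaryFactor]; congr 3; ring

lemma sigmaProd_eq (z : ℂ) :
    L.sigmaProd z = ∏' l : L.lattice, (1 + (elementaryFactor (z / (l : ℂ)) - 1)) := by
  simp only [sigmaProd, sigmaFactor_eq, add_sub_cancel]

lemma eventually_le_norm (R : ℝ) : ∀ᶠ l : L.lattice in cofinite, R ≤ ‖(l : ℂ)‖ := by
  have := tendsto_norm_cocompact_atTop (E := L.lattice)
  rw [cocompact_eq_cofinite] at this
  exact this.eventually_ge_atTop R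

lemma summable_norm_pow_neg_three : Summable fun l : L.lattice => (‖(l : ℂ)‖ ^ 3)⁻¹ := by
  simpa using ZLattice.summable_norm_pow_inv L.lattice 3 (by
    rw [ZLattice.rank ℝ]; simp)

lemma eventually_norm_factor_le {R : ℝ} (hR : 0 < R) :
    ∀ᶠ l : L.lattice in cofinite, ∀ z ∈ ball (0 : ℂ) R,
      ‖elementaryFactor (z / (l : ℂ)) - 1‖ ≤ Real.exp 2 * R ^ 3 * (‖(l : ℂ)‖ ^ 3)⁻¹ := by
  filter_upwards [L.eventually_le_norm R] with l hl z hz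
  have hz : ‖z‖ < R := by simpa using hz
  have hl0 : 0 < ‖(l : ℂ)‖ := hR.trans_le hl
  have h1 : ‖z / (l : ℂ)‖ ≤ 1 := by
    rw [norm_div, div_le_one hl0]; linarith
  refine (norm_elementaryFactor_sub_one_le h1).trans ?_
  rw [norm_div, div_pow, div_eq_mul_inv, ← mul_assoc]
  gcongr

lemma multipliableLocallyUniformlyOn_factor {R : ℝ} (hR : 0 < R) :
    MultipliableLocallyUniformlyOn
      (fun (l : L.lattice) (z : ℂ) => elementaryFactor (z / (l : ℂ))) (ball 0 R) := by
  have := Summable.multipliableLocallyUniformlyOn_one_add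
    (f := fun (l : L.lattice) (z : ℂ) => elementaryFactor (z / (l : ℂ)) - 1) isOpen_ball
    (L.summable_norm_pow_neg_three.mul_left (Real.exp 2 * R ^ 3))
    (L.eventually_norm_factor_le hR)
    (fun l => ((differentiable_elementaryFactor.continuous.comp
      (continuous_id.div_const (l : ℂ))).sub continuous_const).continuousOn)
  simpa only [add_sub_cancel] using this

lemma differentiable_sigmaProd : Differentiable ℂ L.sigmaProd := by
  intro z
  have hR : 0 < ‖z‖ + 1 := by positivity
  have h : DifferentiableOn ℂ (fun z => ∏' l : L.lattice, elementaryFactor (z / (l : ℂ)))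
      (ball 0 (‖z‖ + 1)) := by
    refine (L.multipliableLocallyUniformlyOn_factor hR).hasProdLocallyUniformlyOn.differentiableOn
      (.of_forall fun s => ?_) isOpen_ball
    simpa [Finset.prod_fn] using DifferentiableOn.finsetProd (u := s)
      (f := fun (l : L.lattice) (z : ℂ) => elementaryFactor (z / (l : ℂ))) (𝕜 := ℂ) fun l _ =>
      (differentiable_elementaryFactor.comp (differentiable_id.div_const _)).differentiableOn
  have := h.differentiableAt (isOpen_ball.mem_nhds (show z ∈ ball (0 : ℂ) (‖z‖ + 1) by simp))
  have e : L.sigmaProd = fun z => ∏' l : L.lattice, elementaryFactor (z / (l : ℂ)) := by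
    funext z; simp only [sigmaProd, sigmaFactor_eq]
  rwa [e]

lemma summable_norm_factor_sub_one (z : ℂ) :
    Summable fun l : L.lattice => ‖elementaryFactor (z / (l : ℂ)) - 1‖ := by
  have hR : 0 < ‖z‖ + 1 := by positivity
  refine Summable.of_norm_bounded_eventually
    (L.summable_norm_pow_neg_three.mul_left (Real.exp 2 * (‖z‖ + 1) ^ 3)) ?_
  filter_upwards [L.eventually_norm_factor_le hR] with l hl
  simpa using hl z (by simp)

lemma sigmaProd_ne_zero {z : ℂ} (hz : ∀ l ∈ L.lattice, l ≠ 0 → z ≠ l) : L.sigmaProd z ≠ 0 := by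
  rw [sigmaProd_eq]
  refine tprod_one_add_ne_zero_of_summable (fun l => ?_) (L.summable_norm_factor_sub_one z)
  rw [add_sub_cancel]
  refine elementaryFactor_ne_zero fun h => ?_
  have hl : (l : ℂ) ≠ 0 := by rintro h0; simp [h0] at h
  exact hz l l.2 hl ((div_eq_one_iff_eq hl).1 h)

lemma sigmaProd_zero : L.sigmaProd 0 = 1 := by simp [sigmaProd]

lemma sigmaProd_eq_zero {l : ℂ} (hl : l ∈ L.lattice) (h0 : l ≠ 0) : L.sigmaProd l = 0 :=
  tprod_of_exists_eq_zero ⟨⟨l, hl⟩, by simp [h0]⟩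

lemma weierstrassSigma_eq_zero_iff {z : ℂ} : L.weierstrassSigma z = 0 ↔ z ∈ L.lattice := by
  rw [weierstrassSigma_eq, mul_eq_zero]
  constructor
  · rintro (rfl | h)
    · exact L.lattice.zero_mem
    · by_contra hz
      exact L.sigmaProd_ne_zero (z := z) (fun l hl _ h => hz (h ▸ hl)) h
  · intro hz
    rcases eq_or_ne z 0 with h | h
    · exact Or.inl h
    · exact Or.inr (L.sigmaProd_eq_zero hz h)

lemma differentiable_weierstrassSigma : Differentiable ℂ L.weierstrassSigma :=
  differentiable_id.mul L.differentiable_sigmaProd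

lemma sigmaProd_neg (z : ℂ) : L.sigmaProd (-z) = L.sigmaProd z := by
  rw [sigmaProd, ← (Equiv.neg L.lattice).tprod_eq]
  simp [sigmaProd]

lemma weierstrassSigma_neg (z : ℂ) : L.weierstrassSigma (-z) = -L.weierstrassSigma z := by
  rw [weierstrassSigma_eq, weierstrassSigma_eq, sigmaProd_neg, neg_mul]

lemma weierstrassZeta_neg (z : ℂ) : L.weierstrassZeta (-z) = -L.weierstrassZeta z := by
  have h : deriv L.weierstrassSigma (-z) = deriv L.weierstrassSigma z := by
    have h1 : deriv (fun z => L.weierstrassSigma (-z)) z = -deriv L.weierstrassSigma (-z) :=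
      deriv_comp_neg _ _
    have h2 : (fun z => L.weierstrassSigma (-z)) = fun z => -L.weierstrassSigma z :=
      funext L.weierstrassSigma_neg
    rw [h2, deriv.fun_neg] at h1
    exact (neg_injective h1).symm
  rw [weierstrassZeta, h, weierstrassSigma_neg, div_neg, weierstrassZeta]

/-- The terms of the partial fraction expansion of `ζ`; for `l = 0` the term is `1 / z`. -/
def zetaTerm (l z : ℂ) : ℂ := 1 / (z - l) + 1 / l + z / l ^ 2

lemma logDeriv_factor {l z : ℂ} (h0 : l ≠ 0) (h : z ≠ l) :
    logDeriv (fun z => elementaryFactor (z / l)) z = zetaTerm l z := by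
  have hd : HasDerivAt (fun z => elementaryFactor (z / l))
      (-(z / l) ^ 2 * exp (z / l + (z / l) ^ 2 / 2) * (1 / l)) z :=
    HasDerivAt.comp z (h := fun z => z / l) (hasDerivAt_elementaryFactor (z / l))
      ((hasDerivAt_id z).div_const l)
  have h' : z - l ≠ 0 := sub_ne_zero.2 h
  have h'' : l - z ≠ 0 := sub_ne_zero.2 h.symm
  have h1 : 1 - z / l ≠ 0 := by
    rw [one_sub_div h0]; exact div_ne_zero h'' h0
  rw [logDeriv_apply, hd.deriv, elementaryFactor, zetaTerm]
  have he := exp_ne_zero (z / l + (z / l) ^ 2 / 2)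
  rw [div_eq_iff (mul_ne_zero h1 he)]
  generalize exp (z / l + (z / l) ^ 2 / 2) = E at *
  field_simp
  ring

lemma summable_zetaTerm {z : ℂ} (hz : z ∉ L.lattice) :
    Summable fun l : L.lattice => zetaTerm l z := by
  refine Summable.of_norm_bounded_eventually
    (L.summable_norm_pow_neg_three.mul_left (2 * ‖z‖ ^ 2)) ?_
  filter_upwards [L.eventually_le_norm (2 * ‖z‖ + 1)] with l hl
  have hl0 : (l : ℂ) ≠ 0 := by
    rw [← norm_pos_iff]; linarith [norm_nonneg z]
  have hzl : z - l ≠ 0 := sub_ne_zero.2 fun h => hz (h ▸ l.2)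
  -- The two correction terms cancel the expansion in 1/l up to order two, leaving cubic decay.
  have e : zetaTerm l z = z ^ 2 / (l ^ 2 * (z - l)) := by
    rw [zetaTerm]; field_simp; ring
  have h1 : ‖(l : ℂ)‖ ≤ 2 * ‖z - l‖ := by
    have := norm_sub_norm_le (l : ℂ) z
    rw [norm_sub_rev] at this
    linarith
  have hp : 0 < ‖(l : ℂ)‖ := norm_pos_iff.2 hl0
  rw [e, norm_div, norm_mul, norm_pow, norm_pow]
  rw [div_le_iff₀ (by positivity)]
  have : 2 * ‖z‖ ^ 2 * (‖(l : ℂ)‖ ^ 3)⁻¹ * (‖(l : ℂ)‖ ^ 2 * ‖z - l‖)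
      = ‖z‖ ^ 2 * (2 * ‖z - l‖ / ‖(l : ℂ)‖) := by field_simp
  rw [this]
  exact le_mul_of_one_le_right (by positivity) ((one_le_div hp).2 h1)

/-- Logarithmic differentiation of the product, term by term under locally uniform convergence. -/
lemma hasSum_weierstrassZeta {z : ℂ} (hz : z ∉ L.lattice) :
    HasSum (fun l : L.lattice => zetaTerm l z) (L.weierstrassZeta z) := by
  classical
  have hz0 : z ≠ 0 := fun h => hz (h ▸ L.lattice.zero_mem)
  have hR : 0 < ‖z‖ + 1 := by positivity
  have hne : L.sigmaProd z ≠ 0 := L.sigmaProd_ne_zero fun l hl _ h => hz (h ▸ hl)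
  have eP : L.sigmaProd = fun z => ∏' l : L.lattice, elementaryFactor (z / (l : ℂ)) := by
    funext z; simp only [sigmaProd, sigmaFactor_eq]
  -- For l = 0 the factor is constant while `zetaTerm 0 z` is 1 / z; the difference is the
  -- logarithmic derivative of the leading z in σ.
  have hterm : ∀ l : L.lattice, logDeriv (fun z => elementaryFactor (z / (l : ℂ))) z
      = zetaTerm l z - if l = 0 then 1 / z else 0 := by
    intro l
    split_ifs with h
    · subst h
      simp [zetaTerm, logDeriv_apply]
    · have hl : (l : ℂ) ≠ 0 := by simpa using h
      have hzl : z ≠ l := fun h => hz (h ▸ l.2)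
      rw [logDeriv_factor hl hzl, sub_zero]
  have hs0 : HasSum (fun l : L.lattice => if l = 0 then 1 / z else 0) (1 / z) :=
    hasSum_ite_eq 0 (1 / z)
  have hs := L.summable_zetaTerm hz
  have key := logDeriv_tprod_eq_tsum (s := ball (0 : ℂ) (‖z‖ + 1)) isOpen_ball (x := z) (by simp)
    (f := fun (l : L.lattice) (z : ℂ) => elementaryFactor (z / (l : ℂ)))
    (fun l => elementaryFactor_ne_zero fun h => by
      have hl : (l : ℂ) ≠ 0 := by rintro h0; simp [h0] at h
      exact hz ((div_eq_one_iff_eq hl).1 h ▸ l.2))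
    (fun l => (differentiable_elementaryFactor.comp
      (differentiable_id.div_const _)).differentiableOn)
    (by simpa only [hterm] using hs.sub hs0.summable)
    (L.multipliableLocallyUniformlyOn_factor hR) (by rw [eP] at hne; exact hne)
  have hsig : L.weierstrassZeta z = 1 / z + logDeriv L.sigmaProd z := by
    have : L.weierstrassSigma = fun z => z * L.sigmaProd z := rfl
    rw [weierstrassZeta, ← logDeriv_apply, this,
      logDeriv_mul (f := fun z => z) z hz0 hne differentiableAt_fun_id
        (L.differentiable_sigmaProd z)]
    simp [logDeriv_apply]
  rw [← eP] at key
  simp only [hterm] at key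
  rw [hs.tsum_sub hs0.summable, hs0.tsum_eq] at key
  rw [hsig, key, add_sub_cancel]
  exact hs.hasSum

/-- After the shift l ↦ l + ω the poles cancel, and the two sides differ by (z - z') Σ (1/(l + ω)² -
1/l²). The reflection l ↦ -ω - l changes the sign of this sum, so it is zero. The convention 1/0 = 0
is compatible, because the reflection exchanges 0 and -ω. -/
lemma weierstrassZeta_add_sub {ω : ℂ} (hω : ω ∈ L.lattice) {z z' : ℂ}
    (hz : z ∉ L.lattice) (hz' : z' ∉ L.lattice) :
    L.weierstrassZeta (z + ω) - L.weierstrassZeta z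
      = L.weierstrassZeta (z' + ω) - L.weierstrassZeta z' := by
  have key : ∀ {z : ℂ}, z ∉ L.lattice → HasSum (fun l : L.lattice =>
      1 / ((l : ℂ) + ω) - 1 / l + (z + ω) / ((l : ℂ) + ω) ^ 2 - z / (l : ℂ) ^ 2)
      (L.weierstrassZeta (z + ω) - L.weierstrassZeta z) := by
    intro z hz
    have h1 : z + ω ∉ L.lattice := fun h => hz (by simpa using L.lattice.sub_mem h hω)
    have h2 := (Equiv.addRight (⟨ω, hω⟩ : L.lattice)).hasSum_iff.2 (L.hasSum_weierstrassZeta h1)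
    convert! h2.sub (L.hasSum_weierstrassZeta hz) using 2 with l
    simp only [zetaTerm, Function.comp, Equiv.coe_addRight, Submodule.coe_add,
      add_sub_add_right_eq_sub]
    ring
  have hd := (key hz).sub (key hz')
  set S := L.weierstrassZeta (z + ω) - L.weierstrassZeta z -
    (L.weierstrassZeta (z' + ω) - L.weierstrassZeta z')
  have hd1 : HasSum (fun l : L.lattice =>
      (z - z') * (1 / ((l : ℂ) + ω) ^ 2 - 1 / (l : ℂ) ^ 2)) S := by
    convert! hd using 2 with l
    ring
  have hd2 := ((Equiv.subLeft (-⟨ω, hω⟩ : L.lattice)).hasSum_iff.2 hd1).neg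
  have e : (fun l : L.lattice => -((fun l : L.lattice =>
      (z - z') * (1 / ((l : ℂ) + ω) ^ 2 - 1 / (l : ℂ) ^ 2)) ∘
        (Equiv.subLeft (-⟨ω, hω⟩ : L.lattice))) l) = fun l : L.lattice =>
      (z - z') * (1 / ((l : ℂ) + ω) ^ 2 - 1 / (l : ℂ) ^ 2) := by
    funext l
    simp only [Function.comp, Equiv.subLeft_apply, Submodule.coe_sub, Submodule.coe_neg]
    rw [show (-ω - (l : ℂ) + ω) = -l by ring, show (-ω - (l : ℂ)) = -(l + ω) by ring,
      neg_sq, neg_sq]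
    ring
  rw [e] at hd2
  have := hd1.unique hd2
  exact sub_eq_zero.1 (CharZero.eq_neg_self_iff.1 this)

lemma isConnected_compl_lattice : IsConnected (L.lattice : Set ℂ)ᶜ :=
  Set.Countable.isConnected_compl_of_one_lt_rank (by simp)
    (Set.countable_coe_iff.1 (inferInstanceAs (Countable L.lattice)))

lemma hasDerivAt_weierstrassSigma {z : ℂ} (hz : z ∉ L.lattice) :
    HasDerivAt L.weierstrassSigma (L.weierstrassZeta z * L.weierstrassSigma z) z := by
  rw [weierstrassZeta, div_mul_cancel₀ _ (L.weierstrassSigma_eq_zero_iff.not.2 hz)]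
  exact (L.differentiable_weierstrassSigma z).hasDerivAt

/-- Quasi-periodicity of `σ`, and of `ζ` with the same additive constant. -/
lemma exists_quasiPeriod {ω : ℂ} (hω : ω ∈ L.lattice) :
    ∃ B C : ℂ, C ≠ 0 ∧
      (∀ z ∉ L.lattice, L.weierstrassZeta (z + ω) = L.weierstrassZeta z + B) ∧
      ∀ z, L.weierstrassSigma (z + ω) = C * exp (B * z) * L.weierstrassSigma z := by
  obtain ⟨z₀, hz₀⟩ := L.isConnected_compl_lattice.nonempty
  set B := L.weierstrassZeta (z₀ + ω) - L.weierstrassZeta z₀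
  have hB : ∀ z ∉ L.lattice, L.weierstrassZeta (z + ω) = L.weierstrassZeta z + B :=
    fun z hz => sub_eq_iff_eq_add'.1 (L.weierstrassZeta_add_sub hω hz hz₀)
  have hadd : ∀ {z : ℂ}, z + ω ∈ L.lattice ↔ z ∈ L.lattice :=
    fun {z} => L.lattice.add_mem_iff_left hω
  have hne : ∀ {z : ℂ}, z ∉ L.lattice → L.weierstrassSigma z ≠ 0 :=
    fun hz => L.weierstrassSigma_eq_zero_iff.not.2 hz
  -- The logarithmic derivative of F is ζ(z + ω) - ζ(z) - B = 0, so F is constant on the connected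
  -- complement of the lattice.
  let F : ℂ → ℂ := fun z => L.weierstrassSigma (z + ω) / L.weierstrassSigma z * exp (-(B * z))
  have hF : ∀ z ∈ (L.lattice : Set ℂ)ᶜ, HasDerivAt F 0 z := by
    intro z hz
    have hz : z ∉ L.lattice := hz
    have h1 : HasDerivAt (fun z => L.weierstrassSigma (z + ω)) _ z :=
      (L.hasDerivAt_weierstrassSigma (hadd.not.2 hz)).comp_add_const z ω
    have h2 := (L.hasDerivAt_weierstrassSigma hz)
    have h3 : HasDerivAt (fun z => exp (-(B * z))) (exp (-(B * z)) * -(B * 1)) z :=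
      (((hasDerivAt_id z).const_mul B).neg).cexp
    have hn := hne hz
    have h4 := (h1.fun_div h2 hn).fun_mul h3
    rw [hB z hz] at h4
    convert! h4 using 1
    field_simp
    ring
  have hconst : ∀ z ∉ L.lattice, F z = F z₀ := fun z hz =>
    L.isClosed_lattice.isOpen_compl.is_const_of_deriv_eq_zero
      L.isConnected_compl_lattice.isPreconnected
      (fun z hz => (hF z hz).differentiableAt.differentiableWithinAt)
      (fun z hz => (hF z hz).deriv) hz hz₀
  refine ⟨B, F z₀, mul_ne_zero (div_ne_zero (hne (hadd.not.2 hz₀)) (hne hz₀)) (exp_ne_zero _),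
    hB, fun z => ?_⟩
  by_cases hz : z ∈ L.lattice
  · rw [L.weierstrassSigma_eq_zero_iff.2 hz, L.weierstrassSigma_eq_zero_iff.2 (hadd.2 hz),
      mul_zero]
  · rw [← hconst z hz]
    have := hne hz
    simp only [F]
    have he : exp (-(B * z)) * exp (B * z) = 1 := by rw [← exp_add]; simp
    rw [mul_assoc _ (exp _) (exp _), he, mul_one, div_mul_cancel₀ _ this]

end PeriodPair
end

/-! ### The residue theorem on a rectangle. -/

noncomputable section

open Complex Filter Topology Metric intervalIntegral
open scoped Interval

/-- The primitive is log(p + xi), split into real and imaginary parts; the line lies in the right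
half-plane, so no branch is crossed. -/
lemma integral_I_div {p : ℝ} (hp : 0 < p) (s t : ℝ) :
    ∫ x in s..t, I / ((p : ℂ) + x * I)
      = (((Real.log (p ^ 2 + t ^ 2) - Real.log (p ^ 2 + s ^ 2)) / 2 : ℝ) : ℂ)
        + ((Real.arctan (t / p) - Real.arctan (s / p) : ℝ) : ℂ) * I := by
  have hne : ∀ x : ℝ, (p : ℂ) + x * I ≠ 0 := fun x h => by
    have := congrArg re h
    simp at this
    exact hp.ne' this
  have hd : ∀ x : ℝ, HasDerivAt (fun x : ℝ => ((Real.log (p ^ 2 + x ^ 2) / 2 : ℝ) : ℂ)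
      + ((Real.arctan (x / p) : ℝ) : ℂ) * I) (I / ((p : ℂ) + x * I)) x := by
    intro x
    have hpos : 0 < p ^ 2 + x ^ 2 := by positivity
    have h1 := ((((hasDerivAt_id x).pow 2).const_add (p ^ 2)).log hpos.ne').div_const 2
    have h2 := ((hasDerivAt_id x).div_const p).arctan
    convert! h1.ofReal_comp.add (h2.ofReal_comp.mul_const I) using 1
    have h3 : (1 + (x / p) ^ 2) ≠ 0 := by positivity
    have e1 : (1 / (1 + (id x / p) ^ 2) * (1 / p) : ℝ) = p / (p ^ 2 + x ^ 2) := by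
      simp only [id]; field_simp
    have e2 : ((2 : ℕ) * id x ^ (2 - 1) * 1 / (p ^ 2 + id x ^ 2) / 2 : ℝ)
        = x / (p ^ 2 + x ^ 2) := by
      simp only [id]; field_simp; simp [mul_comm]
    have e1' := congrArg (ofReal) e1
    have e2' := congrArg (ofReal) e2
    simp only [Pi.pow_apply] at *
    rw [e1', e2', div_eq_iff (hne x)]
    have hc : (p : ℂ) ^ 2 + (x : ℂ) ^ 2 ≠ 0 := by exact_mod_cast hpos.ne'
    push_cast
    field_simp
    ring_nf
    rw [I_sq]
    ring
  rw [integral_eq_sub_of_hasDerivAt (fun x _ => hd x)]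
  · push_cast; ring
  · refine Continuous.intervalIntegrable ?_ _ _
    exact continuous_const.div (by fun_prop) hne

/-- The integral of `1 / z` over the boundary of a rectangle that contains `0`. -/
lemma integral_boundary_rect_inv {a b c : ℝ} (ha : 0 < a) (hb : 0 < b) (hc : 0 < c) :
    (∫ x in -a..a, ((x : ℂ) + ((-b : ℝ) : ℂ) * I)⁻¹) - (∫ x in -a..a, ((x : ℂ) + c * I)⁻¹)
      + I * (∫ y in -b..c, ((a : ℂ) + y * I)⁻¹) - I * (∫ y in -b..c, (((-a : ℝ) : ℂ) + y * I)⁻¹)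
      = 2 * Real.pi * I := by
  -- Each side is rotated by a power of i into the right half-plane, where `integral_I_div` applies.
  have e1 : (∫ x in -a..a, ((x : ℂ) + ((-b : ℝ) : ℂ) * I)⁻¹)
      = ∫ x in -a..a, I / ((b : ℂ) + x * I) := by
    congr 1; ext x
    have h : (x : ℂ) + ((-b : ℝ) : ℂ) * I = ((b : ℂ) + x * I) / I := by
      rw [div_I]; push_cast; ring_nf; rw [I_sq]; ring
    rw [h, inv_div]
  have e2 : (∫ x in -a..a, ((x : ℂ) + c * I)⁻¹) = -∫ x in -a..a, I / ((c : ℂ) + x * I) := by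
    have h : (∫ x in -a..a, I / ((c : ℂ) + x * I)) = ∫ x in -a..a, I / ((c : ℂ) - x * I) := by
      have := integral_comp_neg (a := -a) (b := a) (fun x : ℝ => I / ((c : ℂ) + x * I))
      rw [neg_neg] at this
      rw [← this]
      congr 1; ext x; push_cast; congr 1; ring
    rw [h, ← integral_neg]
    congr 1; ext x
    have h' : (x : ℂ) + c * I = -(((c : ℂ) - x * I) / I) := by
      rw [div_I]; ring_nf; rw [I_sq]; ring
    rw [h', inv_neg, inv_div]
  have e3 : I * (∫ y in -b..c, ((a : ℂ) + y * I)⁻¹) = ∫ y in -b..c, I / ((a : ℂ) + y * I) := by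
    rw [← integral_const_mul]; rfl
  have e4 : I * (∫ y in -b..c, (((-a : ℝ) : ℂ) + y * I)⁻¹)
      = -∫ y in -c..b, I / ((a : ℂ) + y * I) := by
    have := integral_comp_neg (a := -c) (b := b)
      (fun y : ℝ => (((-a : ℝ) : ℂ) + y * I)⁻¹)
    rw [neg_neg] at this
    rw [← this, ← integral_const_mul, ← integral_neg]
    congr 1; ext y
    rw [div_eq_mul_inv, ← mul_neg, ← inv_neg]
    congr 2; push_cast; ring
  rw [e1, e2, e3, e4, integral_I_div hb, integral_I_div hc, integral_I_div ha, integral_I_div ha]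
  -- The logarithms cancel, and at each of the four corners arctan t + arctan(1/t) = π/2.
  have h1 := Real.arctan_inv_of_pos (div_pos ha hb)
  have h2 := Real.arctan_inv_of_pos (div_pos ha hc)
  rw [inv_div] at h1 h2
  simp only [neg_div, Real.arctan_neg, neg_sq, h1, h2, add_comm (b ^ 2), add_comm (c ^ 2)]
  push_cast
  ring

/-- The residue theorem for a rectangle and a function `g` that takes the same values on the two
vertical sides: if `0` is the only pole and is simple, then the integrals of `g` over the two
horizontal sides differ by `2 π i` times the residue. -/
lemma integral_sub_integral_eq_residue {a b c : ℝ} (ha : 0 < a) (hb : 0 < b) (hc : 0 < c)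
    {g N : ℂ → ℂ} (hg : ∀ y : ℝ, g (a + y * I) = g (-a + y * I))
    (hN : DifferentiableOn ℂ N ([[-a, a]] ×ℂ [[-b, c]]))
    (hgN : ∀ z ∈ [[-a, a]] ×ℂ [[-b, c]], z ≠ 0 → g z = N z / z) :
    (∫ x in -a..a, g ((x : ℂ) + ((-b : ℝ) : ℂ) * I)) - (∫ x in -a..a, g ((x : ℂ) + c * I))
      = 2 * Real.pi * I * N 0 := by
  have hmem : [[-a, a]] ×ℂ [[-b, c]] ∈ 𝓝 (0 : ℂ) := by
    have : Set.Ioo (-a) a ×ℂ Set.Ioo (-b) c ∈ 𝓝 (0 : ℂ) :=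
      (isOpen_Ioo.reProdIm isOpen_Ioo).mem_nhds (by simp [mem_reProdIm, ha, hb, hc])
    refine mem_of_superset this fun z hz => ?_
    rw [Set.uIcc_of_le (by linarith), Set.uIcc_of_le (by linarith)]
    exact ⟨Set.Ioo_subset_Icc_self hz.1, Set.Ioo_subset_Icc_self hz.2⟩
  -- D is holomorphic and g = N(0)/z + D: Cauchy's theorem removes D, the previous lemma integrates
  -- N(0)/z, and the vertical sides cancel by `hg`.
  set D := dslope N 0
  have hD : DifferentiableOn ℂ D ([[-a, a]] ×ℂ [[-b, c]]) :=
    (differentiableOn_dslope hmem).2 hN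
  have hgD : ∀ z ∈ [[-a, a]] ×ℂ [[-b, c]], z ≠ 0 → g z = N 0 * z⁻¹ + D z := by
    intro z hz h0
    rw [hgN z hz h0, show D z = slope N 0 z from dslope_of_ne _ h0, slope_def_field]
    field_simp
    ring
  have hrect := integral_boundary_rect_eq_zero_of_differentiableOn D (⟨-a, -b⟩) (⟨a, c⟩)
    (by simpa using hD)
  simp only [smul_eq_mul] at hrect
  have hinv := congrArg (N 0 * ·) (integral_boundary_rect_inv ha hb hc)
  simp only [mul_add, mul_sub, mul_left_comm (N 0) I, ← integral_const_mul (N 0)] at hinv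
  have hhor : ∀ y ∈ [[-b, c]], y ≠ 0 → (∫ x in -a..a, g ((x : ℂ) + (y : ℂ) * I))
      = (∫ x in -a..a, N 0 * ((x : ℂ) + (y : ℂ) * I)⁻¹)
        + ∫ x in -a..a, D ((x : ℂ) + (y : ℂ) * I) := by
    intro y hy hy0
    have hne : ∀ x : ℝ, (x : ℂ) + (y : ℂ) * I ≠ 0 := fun x h => hy0 (by simpa using congrArg im h)
    have hm : ∀ x ∈ [[-a, a]], (x : ℂ) + (y : ℂ) * I ∈ [[-a, a]] ×ℂ [[-b, c]] := fun x hx => by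
      rw [mem_reProdIm]; simpa using ⟨hx, hy⟩
    rw [← integral_add]
    · exact integral_congr fun x hx => hgD _ (hm x hx) (hne x)
    · refine Continuous.intervalIntegrable ?_ _ _
      exact continuous_const.mul ((by fun_prop : Continuous _).inv₀ hne)
    · exact (hD.continuousOn.comp (by fun_prop) hm).intervalIntegrable
  have hver : ∀ x ∈ [[-a, a]], x ≠ 0 → (∫ y in -b..c, g ((x : ℂ) + (y : ℂ) * I))
      = (∫ y in -b..c, N 0 * ((x : ℂ) + (y : ℂ) * I)⁻¹)
        + ∫ y in -b..c, D ((x : ℂ) + (y : ℂ) * I) := by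
    intro x hx hx0
    have hne : ∀ y : ℝ, (x : ℂ) + (y : ℂ) * I ≠ 0 := fun y h => hx0 (by simpa using congrArg re h)
    have hm : ∀ y ∈ [[-b, c]], (x : ℂ) + (y : ℂ) * I ∈ [[-a, a]] ×ℂ [[-b, c]] := fun y hy => by
      rw [mem_reProdIm]; simpa using ⟨hx, hy⟩
    rw [← integral_add]
    · exact integral_congr fun y hy => hgD _ (hm y hy) (hne y)
    · refine Continuous.intervalIntegrable ?_ _ _
      exact continuous_const.mul ((by fun_prop : Continuous _).inv₀ hne)
    · exact (hD.continuousOn.comp (by fun_prop) hm).intervalIntegrable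
  have h1 := hhor (-b) Set.left_mem_uIcc (by linarith)
  have h2 := hhor c Set.right_mem_uIcc hc.ne'
  have h3 := hver a Set.right_mem_uIcc ha.ne'
  have h4 := hver (-a) Set.left_mem_uIcc (by linarith)
  have hp : (∫ y in -b..c, g ((a : ℂ) + (y : ℂ) * I))
      = ∫ y in -b..c, g (((-a : ℝ) : ℂ) + (y : ℂ) * I) := by
    congr 1; ext y
    rw [hg, ofReal_neg]
  rw [hp, h4] at h3
  rw [h1, h2]
  linear_combination hrect + hinv + I * h3

end

/-! ### The Legendre relation for a rectangular lattice. -/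

noncomputable section

open Complex Filter Topology Metric intervalIntegral
open scoped Interval

namespace PeriodPair

variable {L : PeriodPair} {ω₁ τ : ℝ}

lemma eq_zero_of_mem_lattice_of_mem_rect (hω₁ : 0 < ω₁) (hτ : 0 < τ)
    (hL₁ : L.ω₁ = 2 * (ω₁ : ℂ)) (hL₂ : L.ω₂ = 2 * ((τ : ℂ) * I))
    {b c : ℝ} (hb : 0 < b) (hc : 0 < c) (hb' : b < 2 * τ) (hc' : c < 2 * τ) {z : ℂ}
    (hz : z ∈ L.lattice) (hr : z ∈ [[-ω₁, ω₁]] ×ℂ [[-b, c]]) : z = 0 := by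
  obtain ⟨m, n, rfl⟩ := mem_lattice.1 hz
  rw [Set.uIcc_of_le (by linarith), Set.uIcc_of_le (by linarith), mem_reProdIm, hL₁, hL₂] at hr
  simp only [add_re, mul_re, intCast_re, intCast_im, add_im, mul_im, re_ofNat, im_ofNat,
    ofReal_re, ofReal_im, I_re, I_im, Set.mem_Icc] at hr
  obtain ⟨⟨h1, h2⟩, h3, h4⟩ := hr
  ring_nf at h1 h2 h3 h4
  have hm : m = 0 := by
    have a1 : (m : ℝ) < 1 := by
      by_contra! h
      nlinarith
    have a2 : (-1 : ℝ) < m := by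
      by_contra! h
      nlinarith
    have a1' : m < 1 := by exact_mod_cast a1
    have a2' : -1 < m := by exact_mod_cast a2
    omega
  have hn : n = 0 := by
    have a1 : (n : ℝ) < 1 := by
      by_contra! h
      nlinarith
    have a2 : (-1 : ℝ) < n := by
      by_contra! h
      nlinarith
    have a1' : n < 1 := by exact_mod_cast a1
    have a2' : -1 < n := by exact_mod_cast a2
    omega
  simp [hm, hn]

lemma sigmaProd_ne_zero_of_mem_rect (hω₁ : 0 < ω₁) (hτ : 0 < τ)
    (hL₁ : L.ω₁ = 2 * (ω₁ : ℂ)) (hL₂ : L.ω₂ = 2 * ((τ : ℂ) * I))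
    {b c : ℝ} (hb : 0 < b) (hc : 0 < c) (hb' : b < 2 * τ) (hc' : c < 2 * τ) {z : ℂ}
    (hr : z ∈ [[-ω₁, ω₁]] ×ℂ [[-b, c]]) : L.sigmaProd z ≠ 0 :=
  L.sigmaProd_ne_zero fun _ hl h0 h => h0
    (eq_zero_of_mem_lattice_of_mem_rect hω₁ hτ hL₁ hL₂ hb hc hb' hc' hl (h ▸ hr))

lemma weierstrassZeta_eq {z : ℂ} (hz : z ≠ 0) (h : L.sigmaProd z ≠ 0) :
    L.weierstrassZeta z = 1 / z + deriv L.sigmaProd z / L.sigmaProd z := by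
  have : L.weierstrassSigma = fun z => z * L.sigmaProd z := rfl
  rw [weierstrassZeta, ← logDeriv_apply, this,
    logDeriv_mul (f := fun z => z) z hz h differentiableAt_fun_id (L.differentiable_sigmaProd z)]
  simp [logDeriv_apply]

/-- The Legendre relation. -/
lemma legendre_relation (hω₁ : 0 < ω₁) (hτ : 0 < τ)
    (hL₁ : L.ω₁ = 2 * (ω₁ : ℂ)) (hL₂ : L.ω₂ = 2 * ((τ : ℂ) * I)) {B₁ B₂ : ℂ}
    (h₁ : ∀ z ∉ L.lattice, L.weierstrassZeta (z + 2 * ω₁) = L.weierstrassZeta z + B₁)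
    (h₂ : ∀ z ∉ L.lattice, L.weierstrassZeta (z + 2 * (τ * I)) = L.weierstrassZeta z + B₂) :
    B₁ * (2 * (τ * I)) - B₂ * (2 * ω₁) = 2 * Real.pi * I := by
  have hω : (ω₁ : ℂ) ≠ 0 := by exact_mod_cast hω₁.ne'
  have hnot : ∀ z : ℂ, (∀ n : ℤ, z.re ≠ n * (2 * ω₁)) ∨ (∀ n : ℤ, z.im ≠ n * (2 * τ)) →
      z ∉ L.lattice := by
    intro z hz hl
    obtain ⟨m, n, h⟩ := mem_lattice.1 hl
    rw [hL₁, hL₂] at h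
    rcases hz with hz | hz
    · exact hz m (by rw [← h]; simp)
    · exact hz n (by rw [← h]; simp)
  have hhalf : ∀ p : ℝ, 0 < p → ∀ n : ℤ, -p ≠ n * (2 * p) := by
    intro p hp n h
    have : (2 * n : ℝ) = -1 := by
      have h' : p * (2 * n + 1) = 0 := by linarith
      rcases mul_eq_zero.1 h' with h'' | h'' <;> linarith
    have : (2 * n : ℤ) = -1 := by exact_mod_cast this
    omega
  -- The linear correction makes g periodic under 2ω₁, so the vertical sides agree; N is z g(z), and
  -- the residue is 1.
  have key := integral_sub_integral_eq_residue hω₁ hτ hτ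
    (g := fun z => L.weierstrassZeta z - B₁ / (2 * ω₁) * z)
    (N := fun z => 1 + z * (deriv L.sigmaProd z / L.sigmaProd z) - B₁ / (2 * ω₁) * z ^ 2)
    (fun y => ?_) ?_ ?_
  · have e : ∀ x : ℝ, L.weierstrassZeta ((x : ℂ) + τ * I)
        = L.weierstrassZeta (x + ((-τ : ℝ) : ℂ) * I) + B₂ := by
      intro x
      rw [← h₂ _ (hnot _ (Or.inr fun n => by simpa using hhalf τ hτ n))]
      congr 1; push_cast; ring
    have hcont : ∀ y : ℝ, (∀ n : ℤ, y ≠ n * (2 * τ)) → IntervalIntegrable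
        (fun x : ℝ => L.weierstrassZeta ((x : ℂ) + y * I) - B₁ / (2 * ω₁) * ((x : ℂ) + y * I))
        MeasureTheory.volume (-ω₁) ω₁ := by
      intro y hy
      refine Continuous.intervalIntegrable ?_ _ _
      refine Continuous.sub ?_ (by fun_prop)
      refine Continuous.div ?_ ?_ fun x => ?_
      · exact (L.differentiable_weierstrassSigma.deriv.continuous).comp (by fun_prop)
      · exact L.differentiable_weierstrassSigma.continuous.comp (by fun_prop)
      · exact L.weierstrassSigma_eq_zero_iff.not.2 (hnot _ (Or.inr fun n => by simpa using hy n))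
    rw [← integral_sub (hcont _ (hhalf τ hτ)) (hcont τ fun n h =>
      hhalf τ hτ (-n) (by push_cast; linarith))] at key
    -- On the horizontal sides g differs by a constant, so the contour integral is that constant
    -- times 2ω₁.
    have e2 : ∀ x : ℝ, L.weierstrassZeta ((x : ℂ) + ((-τ : ℝ) : ℂ) * I)
        - B₁ / (2 * ω₁) * ((x : ℂ) + ((-τ : ℝ) : ℂ) * I)
        - (L.weierstrassZeta ((x : ℂ) + τ * I) - B₁ / (2 * ω₁) * ((x : ℂ) + τ * I))
        = B₁ / (2 * ω₁) * (2 * (τ * I)) - B₂ := by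
      intro x
      rw [e x]; push_cast; ring
    simp only [e2, integral_const] at key
    rw [show ω₁ - -ω₁ = 2 * ω₁ by ring, real_smul] at key
    push_cast at key
    field_simp at key
    simp at key
    apply mul_left_cancel₀ hω
    linear_combination key
  · have := h₁ (-ω₁ + y * I) (hnot _ (Or.inl fun n => by simpa using hhalf ω₁ hω₁ n))
    rw [show -(ω₁ : ℂ) + y * I + 2 * ω₁ = ω₁ + y * I by ring] at this
    simp only [this]
    field_simp
    ring
  · have hd : DifferentiableOn ℂ (fun z => deriv L.sigmaProd z / L.sigmaProd z)
        ([[-ω₁, ω₁]] ×ℂ [[-τ, τ]]) :=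
      L.differentiable_sigmaProd.deriv.differentiableOn.div
        L.differentiable_sigmaProd.differentiableOn fun z hz =>
          sigmaProd_ne_zero_of_mem_rect hω₁ hτ hL₁ hL₂ hτ hτ (by linarith) (by linarith) hz
    exact (((differentiableOn_const _).add (differentiableOn_id.mul hd)).sub
      (by fun_prop))
  · intro z hz h0
    rw [weierstrassZeta_eq h0
      (sigmaProd_ne_zero_of_mem_rect hω₁ hτ hL₁ hL₂ hτ hτ (by linarith) (by linarith) hz)]
    field_simp

/-- The two quasi-periods of a rectangular lattice, with the first one in terms of `ζ(ω₁)` and the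
second one given by the Legendre relation. -/
lemma exists_quasiPeriods (hω₁ : 0 < ω₁) (hτ : 0 < τ)
    (hL₁ : L.ω₁ = 2 * (ω₁ : ℂ)) (hL₂ : L.ω₂ = 2 * ((τ : ℂ) * I)) :
    ∃ C₁ C₂ B₂ : ℂ, C₁ ≠ 0 ∧ C₂ ≠ 0 ∧
      (∀ z, L.weierstrassSigma (z + 2 * ω₁)
        = C₁ * exp (2 * L.weierstrassZeta ω₁ * z) * L.weierstrassSigma z) ∧
      (∀ z, L.weierstrassSigma (z + 2 * (τ * I)) = C₂ * exp (B₂ * z) * L.weierstrassSigma z) ∧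
      2 * L.weierstrassZeta ω₁ * (2 * (τ * I)) - B₂ * (2 * ω₁) = 2 * Real.pi * I := by
  have m₁ := L.ω₁_mem_lattice
  have m₂ := L.ω₂_mem_lattice
  rw [hL₁] at m₁
  rw [hL₂] at m₂
  obtain ⟨B₁, C₁, hC₁, hζ₁, hσ₁⟩ := L.exists_quasiPeriod m₁
  obtain ⟨B₂, C₂, hC₂, hζ₂, hσ₂⟩ := L.exists_quasiPeriod m₂
  -- The translation rule at z = -ω₁, combined with the oddness of ζ.
  have hB : B₁ = 2 * L.weierstrassZeta ω₁ := by
    have hn : (ω₁ : ℂ) ∉ L.lattice := by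
      have := L.ω₁_div_two_notMem_lattice
      rwa [hL₁, mul_div_cancel_left₀ _ (two_ne_zero)] at this
    have := hζ₁ (-ω₁) (fun h => hn (by simpa using L.lattice.neg_mem h))
    rw [weierstrassZeta_neg, show -(ω₁ : ℂ) + 2 * ω₁ = ω₁ by ring] at this
    linear_combination -this
  have hleg := legendre_relation hω₁ hτ hL₁ hL₂ hζ₁ hζ₂
  subst hB
  exact ⟨C₁, C₂, B₂, hC₁, hC₂, hσ₁, hσ₂, hleg⟩

end PeriodPair
end

/-! ### Fourier coefficients of functions of the second kind. -/

noncomputable section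

open Complex Filter Topology Metric intervalIntegral
open scoped Interval

namespace EllipticLBP

variable {L : PeriodPair} {ω₁ τ : ℝ} {κ α β γ : ℂ}

/-- The quasi-period factors of numerator and denominator differ only by exp(Bβ), so the multiplier
does not depend on z. -/
lemma secondKind_add_period {ω B C : ℂ} (hC : C ≠ 0)
    (h : ∀ z, L.weierstrassSigma (z + ω) = C * exp (B * z) * L.weierstrassSigma z) (z : ℂ) :
    secondKind L κ α β γ (z + ω) = exp (B * β + γ * ω) * secondKind L κ α β γ z := by
  have hne : C * exp (B * (z + α)) ≠ 0 := mul_ne_zero hC (exp_ne_zero _)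
  rw [secondKind, secondKind, show z + ω + α + β = z + α + β + ω by ring,
    show z + ω + α = z + α + ω by ring, h, h,
    show C * exp (B * (z + α + β)) * L.weierstrassSigma (z + α + β)
      = C * exp (B * (z + α)) * (exp (B * β) * L.weierstrassSigma (z + α + β)) by
        rw [mul_add B (z + α) β, exp_add]; ring,
    mul_div_mul_left _ _ hne, exp_add, mul_add γ, exp_add]
  ring

lemma secondKind_add_exponent (χ z : ℂ) :
    secondKind L κ α β (γ + χ) z = secondKind L κ α β γ z * exp (χ * z) := by
  rw [secondKind, secondKind, add_mul, exp_add, mul_assoc _ (exp _) (exp _)]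

/-- The line lies strictly between two consecutive rows of lattice points. With z = x + α this keeps
the poles of f off the real axis. -/
lemma notMem_lattice_of_im (hτ : 0 < τ)
    (hL₁ : L.ω₁ = 2 * (ω₁ : ℂ)) (hL₂ : L.ω₂ = 2 * ((τ : ℂ) * I)) {z : ℂ}
    {ν : ℝ} (hν : 0 < ν) (hν' : ν < 1) (hz : z.im = -(2 * ν * τ)) : z ∉ L.lattice := by
  intro h
  obtain ⟨m, n, rfl⟩ := PeriodPair.mem_lattice.1 h
  rw [hL₁, hL₂] at hz
  simp at hz
  have h1 : ((n : ℝ) + ν) * (2 * τ) = 0 := by linarith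
  have h2 : (n : ℝ) = -ν := by
    rcases mul_eq_zero.1 h1 with h | h <;> linarith
  have h3 : (-1 : ℝ) < n := by linarith
  have h4 : (n : ℝ) < 0 := by linarith
  have h3' : -1 < n := by exact_mod_cast h3
  have h4' : n < 0 := by exact_mod_cast h4
  omega

lemma continuous_secondKind (hτ : 0 < τ)
    (hL₁ : L.ω₁ = 2 * (ω₁ : ℂ)) (hL₂ : L.ω₂ = 2 * ((τ : ℂ) * I)) {α₀ ν : ℝ}
    (hν : 0 < ν) (hν' : ν < 1) (hα : α = -(α₀ : ℂ) - 2 * (ν : ℂ) * ((τ : ℂ) * I)) :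
    Continuous fun x : ℝ => secondKind L κ α β γ (x : ℂ) := by
  have hσ := L.differentiable_weierstrassSigma.continuous
  have hne : ∀ x : ℝ, L.weierstrassSigma ((x : ℂ) + α) ≠ 0 := fun x =>
    L.weierstrassSigma_eq_zero_iff.not.2 (notMem_lattice_of_im hτ hL₁ hL₂ hν hν' (by simp [hα]))
  have h1 : Continuous fun x : ℝ => L.weierstrassSigma ((x : ℂ) + α + β) :=
    hσ.comp (by fun_prop)
  have h2 : Continuous fun x : ℝ => L.weierstrassSigma ((x : ℂ) + α) := hσ.comp (by fun_prop)
  exact (continuous_const.mul (h1.div h2 hne)).mul (by fun_prop)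

lemma nome_rpow (ω₁ τ x : ℝ) : nome ω₁ τ ^ x = Real.exp (-(Real.pi * τ / ω₁) * x) := by
  rw [nome, ← Real.exp_mul]

lemma nome_zpow (ω₁ τ : ℝ) (k : ℤ) :
    nome ω₁ τ ^ k = Real.exp (-(Real.pi * τ / ω₁) * k) := by
  rw [← nome_rpow, Real.rpow_intCast]

/-- A zero of the denominator would force β = -2nω₁ - 2kω₃ for some integer n. -/
lemma weight_denom_ne_zero (hω₁ : 0 < ω₁)
    (hL₁ : L.ω₁ = 2 * (ω₁ : ℂ)) (hL₂ : L.ω₂ = 2 * ((τ : ℂ) * I)) (hβ : β ∉ L.lattice) (k : ℤ) :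
    1 - exp (-(I * Real.pi * β / ω₁)) * ((nome ω₁ τ ^ (-2 * k) : ℝ) : ℂ) ≠ 0 := by
  have hω : (ω₁ : ℂ) ≠ 0 := by exact_mod_cast hω₁.ne'
  have hπ : (Real.pi : ℂ) ≠ 0 := by exact_mod_cast Real.pi_ne_zero
  intro h
  rw [nome_zpow, ofReal_exp, ← exp_add, sub_eq_zero, eq_comm, exp_eq_one_iff] at h
  obtain ⟨n, hn⟩ := h
  apply hβ
  rw [PeriodPair.mem_lattice, hL₁, hL₂]
  refine ⟨-n, -k, ?_⟩
  push_cast at hn ⊢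
  field_simp at hn
  have h2 : I * β = I * (-n * (2 * ω₁) + -k * (2 * (τ * I))) := by
    linear_combination -hn + 2 * τ * k * I_sq
  exact (mul_left_cancel₀ I_ne_zero h2).symm

lemma weight_add_mul (α₀ ν : ℝ) {j : ℕ} (hj : 0 < j) (m k : ℤ) :
    weight L ω₁ τ α₀ ν κ β j m (m + j * k) = weight L ω₁ τ α₀ ν κ β 1 0 k := by
  have hj' : (j : ℤ) ≠ 0 := by exact_mod_cast hj.ne'
  have e : (m + j * k - m) = (j : ℤ) * k := by ring
  unfold weight
  rw [e, if_pos (dvd_mul_right _ _), if_pos (by simp), Int.mul_ediv_cancel_left _ hj']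
  simp

/-- The integral over a period of the real line of a function of the second kind with
the real period `2 ω₁`. -/
lemma integral_secondKind (hω₁ : 0 < ω₁) (hτ : 0 < τ)
    (hL₁ : L.ω₁ = 2 * (ω₁ : ℂ)) (hL₂ : L.ω₂ = 2 * ((τ : ℂ) * I)) {α₀ ν : ℝ}
    (hν : 0 < ν) (hν' : ν < 1) (hα : α = -(α₀ : ℂ) - 2 * (ν : ℂ) * ((τ : ℂ) * I))
    (hβ : β ∉ L.lattice) {k : ℤ}
    (hk : ω₁ * γ + L.weierstrassZeta ω₁ * β = -(I * Real.pi * k)) :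
    ∫ x in (0 : ℝ)..2 * ω₁, secondKind L κ α β γ x
      = 2 * ω₁ * weight L ω₁ τ α₀ ν κ β 1 0 k := by
  obtain ⟨C₁, C₂, B₂, hC₁, hC₂, h₁, h₂, hleg⟩ := PeriodPair.exists_quasiPeriods hω₁ hτ hL₁ hL₂
  have hω : (ω₁ : ℂ) ≠ 0 := by exact_mod_cast hω₁.ne'
  set η := L.weierstrassZeta ω₁
  set f := secondKind L κ α β γ
  have hb : 0 < 2 * ν * τ := by positivity
  have hc : 0 < 2 * (1 - ν) * τ := by
    have : 0 < 1 - ν := by linarith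
    positivity
  have hb' : 2 * ν * τ < 2 * τ := by nlinarith
  have hc' : 2 * (1 - ν) * τ < 2 * τ := by nlinarith
  have hper : Function.Periodic f (2 * ω₁) := by
    intro z
    have : exp (2 * η * β + γ * (2 * ω₁)) = 1 := by
      rw [exp_eq_one_iff]
      refine ⟨-k, ?_⟩
      push_cast
      linear_combination 2 * hk
    simp only [f]
    rw [secondKind_add_period hC₁ h₁, this, one_mul]
  set μ := exp (-(I * Real.pi * β / ω₁)) * ((nome ω₁ τ ^ (-2 * k) : ℝ) : ℂ)
  have hμ : 1 - μ ≠ 0 := weight_denom_ne_zero hω₁ hL₁ hL₂ hβ k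
  -- The multiplier is exp(B₂β + 2γω₃); Legendre's relation eliminates B₂ and `hk` eliminates γ.
  have hτper : ∀ z, f (z + 2 * (τ * I)) = μ * f z := by
    intro z
    simp only [f]
    rw [secondKind_add_period hC₂ h₂]
    congr 1
    simp only [μ]
    rw [nome_zpow, ofReal_exp, ← exp_add]
    congr 1
    push_cast
    field_simp
    linear_combination 2 * τ * I * hk - β / 2 * hleg - 2 * Real.pi * k * τ * I_sq
  -- The shift by α moves the pole to 0. The lower side then maps to the real line, translated by
  -- α₀, and the heights add up to 2τ, so the upper side is its translate by 2ω₃.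
  have key := integral_sub_integral_eq_residue hω₁ hb hc
    (g := fun z => f (z - α))
    (N := fun z => κ * L.weierstrassSigma (z + β) / L.sigmaProd z * exp (γ * (z - α)))
    (fun y => ?_) ?_ ?_
  · have hlow : (∫ x in -ω₁..ω₁, f ((x : ℂ) + ((-(2 * ν * τ) : ℝ) : ℂ) * I - α))
        = ∫ x in (0 : ℝ)..2 * ω₁, f x := by
      have e : ∀ x : ℝ, (x : ℂ) + ((-(2 * ν * τ) : ℝ) : ℂ) * I - α = ((x + α₀ : ℝ) : ℂ) := by
        intro x; rw [hα]; push_cast; ring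
      have hp : Function.Periodic (fun x : ℝ => f x) (2 * ω₁) := fun x => by
        simpa using hper x
      simp only [e]
      rw [integral_comp_add_right (fun x : ℝ => f x)]
      have := hp.intervalIntegral_add_eq (-ω₁ + α₀) 0
      rw [zero_add, show -ω₁ + α₀ + 2 * ω₁ = ω₁ + α₀ by ring] at this
      exact this
    have hhigh : (∫ x in -ω₁..ω₁, f ((x : ℂ) + ((2 * (1 - ν) * τ : ℝ) : ℂ) * I - α))
        = μ * ∫ x in -ω₁..ω₁, f ((x : ℂ) + ((-(2 * ν * τ) : ℝ) : ℂ) * I - α) := by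
      rw [← integral_const_mul]
      congr 1; ext x
      rw [← hτper]
      congr 1; push_cast; ring
    rw [hhigh, hlow] at key
    have hw : weight L ω₁ τ α₀ ν κ β 1 0 k = 2 * Real.pi * I * residueConst L ω₁ κ α β *
        exp (-(I * Real.pi * α₀ * k / ω₁)) * ((nome ω₁ τ ^ (-2 * ν * (k : ℝ)) : ℝ) : ℂ)
          / (1 - μ) := by
      simp [weight, μ, hα]
    rw [hw, ← mul_div_assoc, eq_div_iff hμ]
    simp only [L.sigmaProd_zero, zero_add, zero_sub, div_one] at key
    -- The residue contains exp(-γα). Solving `hk` for γ splits it into the exponential of R₀, the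
    -- phase in α₀ and the power of h.
    have he : exp (γ * -α) = exp (α * β * η / ω₁) * exp (-(I * Real.pi * α₀ * k / ω₁))
        * ((nome ω₁ τ ^ (-2 * ν * (k : ℝ)) : ℝ) : ℂ) := by
      rw [nome_rpow, ofReal_exp, ← exp_add, ← exp_add]
      congr 1
      push_cast
      field_simp
      have hα' : α * (I * Real.pi * k) = -(I * Real.pi * α₀ * k) + 2 * ν * k * Real.pi * τ := by
        rw [hα]
        linear_combination (-2) * ν * τ * Real.pi * k * I_sq
      linear_combination (-α) * hk + hα'
    rw [he] at key
    rw [residueConst]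
    generalize exp (α * β * η / ω₁) = E₁ at key ⊢
    generalize exp (-(I * Real.pi * α₀ * k / ω₁)) = E₂ at key ⊢
    generalize nome ω₁ τ ^ (-2 * ν * (k : ℝ)) = E₃ at key ⊢
    field_simp
    linear_combination key
  · have := hper (-ω₁ + y * I - α)
    rw [← this]
    congr 1; ring
  · refine DifferentiableOn.mul (DifferentiableOn.div ?_ ?_ fun z hz => ?_) (by fun_prop)
    · exact ((L.differentiable_weierstrassSigma.comp (by fun_prop)).const_mul κ).differentiableOn
    · exact L.differentiable_sigmaProd.differentiableOn
    · exact PeriodPair.sigmaProd_ne_zero_of_mem_rect hω₁ hτ hL₁ hL₂ hb hc hb' hc' hz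
  · intro z _ h0
    simp only [f, secondKind, sub_add_cancel, L.weierstrassSigma_eq z]
    field_simp

lemma periodic_secondKind (hω₁ : 0 < ω₁) (hτ : 0 < τ)
    (hL₁ : L.ω₁ = 2 * (ω₁ : ℂ)) (hL₂ : L.ω₂ = 2 * ((τ : ℂ) * I)) (z : ℂ) :
    secondKind L κ α β γ (z + 2 * ω₁)
      = exp (2 * (ω₁ * γ + L.weierstrassZeta ω₁ * β)) * secondKind L κ α β γ z := by
  obtain ⟨C₁, C₂, B₂, hC₁, hC₂, h₁, h₂, hleg⟩ := PeriodPair.exists_quasiPeriods hω₁ hτ hL₁ hL₂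
  rw [secondKind_add_period hC₁ h₁]
  congr 2; ring

lemma secondKind_add_nat_mul (hω₁ : 0 < ω₁) (hτ : 0 < τ)
    (hL₁ : L.ω₁ = 2 * (ω₁ : ℂ)) (hL₂ : L.ω₂ = 2 * ((τ : ℂ) * I)) (z : ℂ) (j : ℕ) :
    secondKind L κ α β γ (z + 2 * ω₁ * j)
      = exp (2 * (ω₁ * γ + L.weierstrassZeta ω₁ * β)) ^ j * secondKind L κ α β γ z := by
  induction j with
  | zero => simp
  | succ j ih =>
    rw [Nat.cast_succ, mul_add, mul_one, ← add_assoc, periodic_secondKind hω₁ hτ hL₁ hL₂, ih,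
      pow_succ]
    ring

/-- The Fourier character is absorbed into the exponent δ. Each step by 2ω₁ then multiplies by ξ
with ξ^j = 1, so the integral over j steps has the factor Σ ξ^r, which is j if s ≡ m mod j and 0
otherwise. -/
lemma fourierCoefficient_secondKind (hω₁ : 0 < ω₁) (hτ : 0 < τ)
    (hL₁ : L.ω₁ = 2 * (ω₁ : ℂ)) (hL₂ : L.ω₂ = 2 * ((τ : ℂ) * I)) {α₀ ν : ℝ}
    (hν : 0 < ν) (hν' : ν < 1) (hα : α = -(α₀ : ℂ) - 2 * (ν : ℂ) * ((τ : ℂ) * I))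
    (hβ : β ∉ L.lattice) {j : ℕ} (hj : 0 < j) {m : ℤ}
    (hm : ω₁ * γ + L.weierstrassZeta ω₁ * β = I * Real.pi * m / j) (s : ℤ) :
    fourierCoefficient (2 * ω₁ * j) (secondKind L κ α β γ) s
      = weight L ω₁ τ α₀ ν κ β j m s := by
  have hω : (ω₁ : ℂ) ≠ 0 := by exact_mod_cast hω₁.ne'
  have hj0 : (j : ℂ) ≠ 0 := by exact_mod_cast hj.ne'
  set δ : ℂ := γ + -(I * Real.pi * s / (j * ω₁))
  set G : ℝ → ℂ := fun x => secondKind L κ α β δ x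
  have hδ : ω₁ * δ + L.weierstrassZeta ω₁ * β = I * Real.pi * (m - s) / j := by
    simp only [δ]
    rw [mul_add, add_right_comm, hm]
    field_simp
    ring
  have hint : fourierCoefficient (2 * ω₁ * j) (secondKind L κ α β γ) s
      = 1 / (2 * ω₁ * j) * ∫ x in (0 : ℝ)..2 * ω₁ * j, G x := by
    rw [fourierCoefficient]
    push_cast
    congr 2; ext x
    simp only [G, δ]
    rw [secondKind_add_exponent]
    congr 2
    field_simp
  set ξ : ℂ := exp (2 * (ω₁ * δ + L.weierstrassZeta ω₁ * β))
  have hGr : ∀ (r : ℕ) (x : ℝ), G (x + 2 * ω₁ * r) = ξ ^ r * G x := fun r x => by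
    simpa [G] using secondKind_add_nat_mul hω₁ hτ hL₁ hL₂ (x : ℂ) r
  have hcont : Continuous G := continuous_secondKind hτ hL₁ hL₂ hν hν' hα
  have hsum : (∫ x in (0 : ℝ)..2 * ω₁ * j, G x)
      = (∑ r ∈ Finset.range j, ξ ^ r) * ∫ x in (0 : ℝ)..2 * ω₁, G x := by
    have := sum_integral_adjacent_intervals (μ := MeasureTheory.volume) (f := G)
      (a := fun r : ℕ => 2 * ω₁ * r) (n := j) (fun r _ => hcont.intervalIntegrable _ _)
    simp only [Nat.cast_zero, mul_zero] at this
    rw [← this, Finset.sum_mul]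
    refine Finset.sum_congr rfl fun r _ => ?_
    rw [← integral_const_mul]
    simp only [← hGr]
    rw [integral_comp_add_right, zero_add]
    congr 1
    push_cast; ring
  rw [hint, hsum]
  by_cases hd : (j : ℤ) ∣ s - m
  · obtain ⟨k, hk⟩ := hd
    have hs : s = m + j * k := by linarith
    have hk' : ω₁ * δ + L.weierstrassZeta ω₁ * β = -(I * Real.pi * k) := by
      rw [hδ, hs]; push_cast; field_simp; ring
    have hξ : ξ = 1 := by
      simp only [ξ]
      rw [hk', exp_eq_one_iff]
      exact ⟨-k, by push_cast; ring⟩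
    rw [integral_secondKind hω₁ hτ hL₁ hL₂ hν hν' hα hβ hk', hξ, hs, weight_add_mul α₀ ν hj]
    simp
    field_simp
  · have hw : weight L ω₁ τ α₀ ν κ β j m s = 0 := by rw [weight, if_neg hd]
    have hξj : ξ ^ j = 1 := by
      simp only [ξ]
      rw [← exp_nat_mul, hδ, exp_eq_one_iff]
      exact ⟨m - s, by push_cast; field_simp⟩
    have hξ : ξ ≠ 1 := by
      simp only [ξ]
      rw [hδ]
      intro h
      obtain ⟨n, hn⟩ := exp_eq_one_iff.1 h
      apply hd
      have h2 : ((m - s : ℤ) : ℂ) = ((j * n : ℤ) : ℂ) := by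
        have hπ : (2 * Real.pi * I : ℂ) ≠ 0 := two_pi_I_ne_zero
        apply mul_left_cancel₀ hπ
        field_simp at hn
        push_cast
        linear_combination 2 * Real.pi * I * hn
      exact ⟨-n, by have := Int.cast_injective h2; linarith⟩
    rw [hw, geom_sum_eq hξ, hξj]
    simp

end EllipticLBP
end

/-! ### Bordered determinants and biorthogonality. -/

noncomputable section

namespace EllipticLBP

open Finset

/-- The determinant of the `(n + 1) × (n + 1)` matrix with rows `a 0, …, a (n - 1), v`. -/
def borderedDet (a : ℕ → ℕ → ℂ) (n : ℕ) (v : ℕ → ℂ) : ℂ :=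
  Matrix.det (Matrix.of fun i k : Fin (n + 1) => if (i : ℕ) < n then a i k else v k)

lemma borderedDet_eq_sum_cofactor (a : ℕ → ℕ → ℂ) (n : ℕ) (v : ℕ → ℂ) :
    borderedDet a n v = ∑ k : Fin (n + 1), (-1) ^ (n + (k : ℕ)) * v k *
      Matrix.det (Matrix.of fun i l : Fin n => a i (k.succAbove l)) := by
  rw [borderedDet, Matrix.det_succ_row _ (Fin.last n)]
  refine sum_congr rfl fun k _ => ?_
  congr 2
  · simp
  · ext i l
    simp

/-- Linearity in the last row; this is what lets a pairing or a sum over nodes act on that row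
alone. -/
lemma borderedDet_eq_sum (a : ℕ → ℕ → ℂ) (n : ℕ) (v : ℕ → ℂ) :
    borderedDet a n v = ∑ k ∈ range (n + 1), v k * borderedDet a n (Pi.single k 1) := by
  rw [sum_range, borderedDet_eq_sum_cofactor]
  refine sum_congr rfl fun k _ => ?_
  rw [borderedDet_eq_sum_cofactor, Finset.sum_eq_single k]
  · simp only [Pi.single_eq_same]; ring
  · intro l _ hl
    rw [Pi.single_eq_of_ne (by simpa [Fin.ext_iff] using hl)]; ring
  · simp

lemma borderedDet_single_self (a : ℕ → ℕ → ℂ) (n : ℕ) :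
    borderedDet a n (Pi.single n 1) = Matrix.det (Matrix.of fun i k : Fin n => a i k) := by
  rw [borderedDet_eq_sum_cofactor, Finset.sum_eq_single (Fin.last n)]
  · simp [← two_mul]
  · intro l _ hl
    rw [Pi.single_eq_of_ne (by simpa [Fin.ext_iff] using hl)]; ring
  · simp

lemma borderedDet_row {a : ℕ → ℕ → ℂ} {n i : ℕ} (hi : i < n) : borderedDet a n (a i) = 0 := by
  refine Matrix.det_zero_of_row_eq (i := ⟨i, by omega⟩) (j := Fin.last n) ?_ ?_
  · simpa [Fin.ext_iff] using hi.ne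
  · ext k
    simp [hi]

lemma borderedDet_row_self (a : ℕ → ℕ → ℂ) (n : ℕ) :
    borderedDet a n (a n) = Matrix.det (Matrix.of fun i k : Fin (n + 1) => a i k) := by
  rw [borderedDet]
  congr 1
  ext i k
  simp only [Matrix.of_apply]
  split_ifs with h
  · rfl
  · rw [show (i : ℕ) = n by omega]

/-- Columns carry q^k for k ≤ n and rows carry q^(-i) only for i < n, so a single q^n is left over.
-/
lemma borderedDet_pow_scale {a b : ℕ → ℕ → ℂ} {q : ℂ} (hq : q ≠ 0)
    (hab : ∀ i k : ℕ, b i k = q ^ ((k : ℤ) - (i : ℤ)) * a i k) (n : ℕ) (z : ℂ) :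
    borderedDet b n (fun k => z ^ k) = q ^ n * borderedDet a n (fun k => (z / q) ^ k) := by
  have e : (Matrix.of fun i k : Fin (n + 1) => if (i : ℕ) < n then b i k else z ^ (k : ℕ))
      = Matrix.of fun i k : Fin (n + 1) =>
        (if (i : ℕ) < n then (q ^ (i : ℕ))⁻¹ else 1) *
          (Matrix.of fun i k : Fin (n + 1) => q ^ (k : ℕ) *
            (Matrix.of fun i k : Fin (n + 1) =>
              if (i : ℕ) < n then a i k else (z / q) ^ (k : ℕ)) i k) i k := by
    ext i k
    simp only [Matrix.of_apply]
    split_ifs with h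
    · rw [hab, zpow_sub₀ hq]
      simp only [zpow_natCast]
      field_simp
    · rw [one_mul, ← mul_pow, mul_div_cancel₀ _ hq]
  rw [borderedDet, e, Matrix.det_mul_column, Matrix.det_mul_row, ← mul_assoc, borderedDet]
  congr 1
  rw [← prod_mul_distrib, Fin.prod_univ_castSucc]
  simp [hq]

lemma toeplitzDet_scale {c d : ℤ → ℂ} {q : ℂ} (hq : q ≠ 0) (hd : ∀ n, d n = q ^ n * c n)
    (n : ℕ) : toeplitzDet d n = toeplitzDet c n := by
  have e : (Matrix.of fun i k : Fin n => d ((k : ℤ) - (i : ℤ)))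
      = Matrix.of fun i k : Fin n => (q ^ (i : ℕ))⁻¹ *
          (Matrix.of fun i k : Fin n => q ^ (k : ℕ) *
            (Matrix.of fun i k : Fin n => c ((k : ℤ) - (i : ℤ))) i k) i k := by
    ext i k
    simp only [Matrix.of_apply]
    rw [hd, zpow_sub₀ hq]
    simp only [zpow_natCast]
    field_simp
  rw [toeplitzDet, e, Matrix.det_mul_column, Matrix.det_mul_row, ← mul_assoc, ← prod_mul_distrib,
    toeplitzDet]
  simp [hq]

lemma toeplitzDet_eq_transpose (c : ℤ → ℂ) (n : ℕ) :
    Matrix.det (Matrix.of fun i k : Fin n => c ((i : ℤ) - (k : ℤ))) = toeplitzDet c n := by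
  rw [toeplitzDet, ← Matrix.det_transpose]
  rfl

lemma eval_lbp (c : ℤ → ℂ) (n : ℕ) (z : ℂ) :
    (lbp c n).eval z = (toeplitzDet c n)⁻¹ *
      borderedDet (fun i k => c ((k : ℤ) - (i : ℤ))) n (fun k => z ^ k) := by
  rw [lbp, Polynomial.eval_mul, Polynomial.eval_C, borderedDet, ← Polynomial.coe_evalRingHom,
    RingHom.map_det]
  congr 2
  ext i k
  simp only [RingHom.mapMatrix_apply, Matrix.map_apply, Matrix.of_apply]
  split_ifs <;> simp

lemma eval_lbpPartner (c : ℤ → ℂ) (n : ℕ) (z : ℂ) :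
    (lbpPartner c n).eval z = (toeplitzDet c n)⁻¹ *
      borderedDet (fun i k => c ((i : ℤ) - (k : ℤ))) n (fun k => z ^ k) := by
  rw [lbpPartner, Polynomial.eval_mul, Polynomial.eval_C, borderedDet,
    ← Polynomial.coe_evalRingHom, RingHom.map_det]
  congr 2
  ext i k
  simp only [RingHom.mapMatrix_apply, Matrix.map_apply, Matrix.of_apply]
  split_ifs <;> simp

lemma eval_lbp_scale {c d : ℤ → ℂ} {q : ℂ} (hq : q ≠ 0) (hd : ∀ n, d n = q ^ n * c n)
    (n : ℕ) (z : ℂ) : (lbp d n).eval z = q ^ n * (lbp c n).eval (z / q) := by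
  rw [eval_lbp, eval_lbp, toeplitzDet_scale hq hd,
    borderedDet_pow_scale (a := fun i k => c ((k : ℤ) - (i : ℤ))) hq (fun i k => hd _)]
  ring

lemma eval_lbpPartner_scale {c d : ℤ → ℂ} {q : ℂ} (hq : q ≠ 0) (hd : ∀ n, d n = q ^ n * c n)
    (n : ℕ) (z : ℂ) : (lbpPartner d n).eval z = (q ^ n)⁻¹ * (lbpPartner c n).eval (q * z) := by
  rw [eval_lbpPartner, eval_lbpPartner, toeplitzDet_scale hq hd,
    borderedDet_pow_scale (a := fun i k => c ((i : ℤ) - (k : ℤ))) (inv_ne_zero hq) fun i k => by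
      rw [hd, inv_zpow', neg_sub]]
  rw [div_inv_eq_mul, mul_comm z, inv_pow]
  ring

lemma normConst_scale {c d : ℤ → ℂ} {q : ℂ} (hq : q ≠ 0) (hd : ∀ n, d n = q ^ n * c n)
    (n : ℕ) : normConst d n = normConst c n := by
  rw [normConst, normConst, toeplitzDet_scale hq hd, toeplitzDet_scale hq hd]

/-- If a pairing against `A` of the powers of the nodes gives the rows of a matrix, then a
polynomial given by a bordered determinant pairs to the bordered determinants of numbers. -/
lemma hasSum_mul_borderedDet {ι : Type*} {A y : ι → ℂ} {r : ℕ → ℂ} {n : ℕ}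
    (h : ∀ k ≤ n, HasSum (fun s => A s * y s ^ k) (r k)) (a : ℕ → ℕ → ℂ) :
    HasSum (fun s => A s * borderedDet a n (fun k => y s ^ k)) (borderedDet a n r) := by
  rw [borderedDet_eq_sum a n r]
  have := hasSum_sum (s := range (n + 1)) fun k hk =>
    (h k (Nat.lt_succ_iff.1 (mem_range.1 hk))).mul_right (borderedDet a n (Pi.single k 1))
  convert! this using 2 with s
  rw [borderedDet_eq_sum, mul_sum]
  exact sum_congr rfl fun k _ => by ring

/-- The pairing turns the last row of powers into moment row i. The result is 0 for i < n by equal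
rows, and Δ_{n+1}/Δ_n for i = n. -/
lemma hasSum_lbp_mul_inv_pow {c A x : ℤ → ℂ} (hx : ∀ s, x s ≠ 0)
    (hc : ∀ n : ℤ, HasSum (fun s => A s * x s ^ n) (c n)) (n i : ℕ) :
    HasSum (fun s => A s * (lbp c n).eval (x s) * (1 / x s) ^ i)
      ((toeplitzDet c n)⁻¹ * borderedDet (fun i k => c ((k : ℤ) - (i : ℤ))) n
        (fun k => c ((k : ℤ) - (i : ℤ)))) := by
  have h := (hasSum_mul_borderedDet (n := n) (A := fun s => A s * (1 / x s) ^ i) (y := x)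
    (r := fun k => c ((k : ℤ) - (i : ℤ))) (fun k _ => ?_)
    (fun i k => c ((k : ℤ) - (i : ℤ)))).mul_left (toeplitzDet c n)⁻¹
  · convert! h using 2 with s
    rw [eval_lbp]; ring
  · convert! hc ((k : ℤ) - (i : ℤ)) using 2 with s
    rw [zpow_sub₀ (hx s), zpow_natCast, zpow_natCast, one_div, inv_pow]
    ring

lemma hasSum_lbpPartner_mul_pow {c A x : ℤ → ℂ} (hx : ∀ s, x s ≠ 0)
    (hc : ∀ n : ℤ, HasSum (fun s => A s * x s ^ n) (c n)) (n i : ℕ) :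
    HasSum (fun s => A s * x s ^ i * (lbpPartner c n).eval (1 / x s))
      ((toeplitzDet c n)⁻¹ * borderedDet (fun i k => c ((i : ℤ) - (k : ℤ))) n
        (fun k => c ((i : ℤ) - (k : ℤ)))) := by
  have h := (hasSum_mul_borderedDet (n := n) (A := fun s => A s * x s ^ i) (y := fun s => 1 / x s)
    (r := fun k => c ((i : ℤ) - (k : ℤ))) (fun k _ => ?_)
    (fun i k => c ((i : ℤ) - (k : ℤ)))).mul_left (toeplitzDet c n)⁻¹
  · convert! h using 2 with s
    rw [eval_lbpPartner]; ring
  · convert! hc ((i : ℤ) - (k : ℤ)) using 2 with s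
    rw [zpow_sub₀ (hx s), zpow_natCast, zpow_natCast, one_div, inv_pow]
    ring

/-- Biorthogonality of the Laurent biorthogonal polynomials of the moments of a discrete measure. -/
theorem hasSum_lbp_mul_lbpPartner {c A x : ℤ → ℂ} (hx : ∀ s, x s ≠ 0)
    (hc : ∀ n : ℤ, HasSum (fun s => A s * x s ^ n) (c n)) (hΔ : ∀ n, toeplitzDet c n ≠ 0) (n n' : ℕ) :
    HasSum (fun s => A s * (lbp c n).eval (x s) * (lbpPartner c n').eval (1 / x s))
      (if n = n' then normConst c n else 0) := by
  rcases le_or_gt n' n with hn | hn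
  · have h := (hasSum_mul_borderedDet (n := n') (A := fun s => A s * (lbp c n).eval (x s))
      (y := fun s => 1 / x s) (fun k _ => hasSum_lbp_mul_inv_pow hx hc n k)
      (fun i k => c ((i : ℤ) - (k : ℤ)))).mul_left (toeplitzDet c n')⁻¹
    convert! h using 1
    · ext s; rw [eval_lbpPartner]; ring
    -- Powers k < n' ≤ n pair to zero with P_n. Only the leading term of Q_{n'} survives, and its
    -- cofactor is Δ_{n'}.
    · rw [borderedDet_eq_sum, Finset.sum_eq_single n']
      · rw [borderedDet_single_self, toeplitzDet_eq_transpose]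
        have := hΔ n'
        split_ifs with hnn
        · subst hnn
          rw [borderedDet_row_self (fun i k => c ((k : ℤ) - (i : ℤ))), ← toeplitzDet, normConst]
          field_simp
        · rw [borderedDet_row (a := fun i k => c ((k : ℤ) - (i : ℤ)))
            (lt_of_le_of_ne hn (Ne.symm hnn))]
          simp
      · intro k hk hk'
        rw [mem_range] at hk
        rw [borderedDet_row (a := fun i k => c ((k : ℤ) - (i : ℤ))) (by omega)]
        simp
      · simp
  -- For n < n' the roles are exchanged: Q_{n'} annihilates every power k ≤ n occurring in P_n.
  · have h := (hasSum_mul_borderedDet (n := n) (A := fun s => A s * (lbpPartner c n').eval (1 / x s))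
      (y := x) (r := fun _ => 0) (fun k hk => ?_)
      (fun i k => c ((k : ℤ) - (i : ℤ)))).mul_left (toeplitzDet c n)⁻¹
    · rw [if_neg hn.ne]
      convert! h using 1
      · ext s; rw [eval_lbp]; ring
      · rw [borderedDet_eq_sum]; simp
    · have := hasSum_lbpPartner_mul_pow hx hc n' k
      rw [borderedDet_row (a := fun i k => c ((i : ℤ) - (k : ℤ))) (by omega), mul_zero] at this
      convert! this using 2 with s
      ring

end EllipticLBP
end

/-! ### Nodes and weights: distinctness, density, summability. -/

noncomputable section

namespace EllipticLBP

open Complex Filter Topology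

section
variable {ω₁ w : ℝ}

lemma node_eq_exp_mul_I (ω₁ w : ℝ) (j : ℕ) (s : ℤ) :
    node ω₁ w j s = exp (((Real.pi * s * w / (j * ω₁) : ℝ) : ℂ) * I) := by
  rw [node]; congr 1; push_cast; ring

lemma norm_node (ω₁ w : ℝ) (j : ℕ) (s : ℤ) : ‖node ω₁ w j s‖ = 1 := by
  rw [node_eq_exp_mul_I, norm_exp_ofReal_mul_I]

lemma node_ne_zero (ω₁ w : ℝ) (j : ℕ) (s : ℤ) : node ω₁ w j s ≠ 0 := exp_ne_zero _

lemma node_injective (hω₁ : 0 < ω₁)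
    (hw : ∀ N₁ N₂ : ℤ, (N₁, N₂) ≠ (0, 0) → w * (N₁ : ℝ) ≠ ω₁ * (N₂ : ℝ)) {j : ℕ} (hj : 0 < j) :
    Function.Injective (node ω₁ w j) := by
  intro s t h
  rw [node, node, exp_eq_exp_iff_exists_int] at h
  obtain ⟨n, hn⟩ := h
  have hω : (ω₁ : ℂ) ≠ 0 := by exact_mod_cast hω₁.ne'
  have hj0 : (j : ℂ) ≠ 0 := by exact_mod_cast hj.ne'
  have hπ : (Real.pi : ℂ) * I ≠ 0 := mul_ne_zero (by exact_mod_cast Real.pi_ne_zero) I_ne_zero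
  have h1 : (w * (s - t : ℤ) : ℂ) = ω₁ * (2 * j * n : ℤ) := by
    apply mul_left_cancel₀ hπ
    field_simp at hn
    push_cast
    linear_combination Real.pi * I * hn
  by_contra hst
  refine hw (s - t) (2 * j * n) (fun h => hst ?_) (by exact_mod_cast h1)
  have := congrArg Prod.fst h
  simp only at this
  omega

lemma irrational_div (hω₁ : 0 < ω₁)
    (hw : ∀ N₁ N₂ : ℤ, (N₁, N₂) ≠ (0, 0) → w * (N₁ : ℝ) ≠ ω₁ * (N₂ : ℝ)) :
    Irrational (w / (2 * ω₁)) := by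
  rintro ⟨r, hr⟩
  have hd : (r.den : ℝ) ≠ 0 := by exact_mod_cast r.den_nz
  refine hw r.den (2 * r.num) (fun h => ?_) ?_
  · have := congrArg Prod.fst h
    simp at this
  · rw [Rat.cast_def] at hr
    field_simp at hr
    push_cast
    linarith

/-- Since z_{m+jk} = z_m exp(iπkw/ω₁), these nodes are the image of the multiples of w in ℝ/2ω₁ℤ,
dense by irrationality of w/(2ω₁), under a continuous map onto the unit circle. -/
lemma dense_node (hω₁ : 0 < ω₁)
    (hw : ∀ N₁ N₂ : ℤ, (N₁, N₂) ≠ (0, 0) → w * (N₁ : ℝ) ≠ ω₁ * (N₂ : ℝ)) {j : ℕ} (hj : 0 < j)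
    (m : ℤ) : Metric.sphere (0 : ℂ) 1 ⊆
      closure (Set.range fun k : ℤ => node ω₁ w j (m + j * k)) := by
  have hdense : DenseRange (· • w : ℤ → AddCircle (2 * ω₁)) :=
    AddCircle.denseRange_zsmul_coe_iff.2 (irrational_div hω₁ hw)
  have hT : 2 * ω₁ ≠ 0 := by positivity
  have hω : (ω₁ : ℂ) ≠ 0 := by exact_mod_cast hω₁.ne'
  have hj0 : (j : ℂ) ≠ 0 := by exact_mod_cast hj.ne'
  have hcont : Continuous fun t : AddCircle (2 * ω₁) =>
      node ω₁ w j m * (AddCircle.toCircle t : ℂ) :=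
    continuous_const.mul (continuous_subtype_val.comp AddCircle.continuous_toCircle)
  have hsub := hcont.range_subset_closure_image_dense hdense
  intro z hz
  have hz1 : ‖z‖ = 1 := by simpa using hz
  have hmem : z / node ω₁ w j m ∈ Submonoid.unitSphere ℂ :=
    mem_sphere_zero_iff_norm.2 (by simp [norm_node, hz1])
  obtain ⟨t, ht⟩ := (AddCircle.homeomorphCircle hT).surjective ⟨_, hmem⟩
  have hzt : z = node ω₁ w j m * (AddCircle.toCircle t : ℂ) := by
    rw [AddCircle.homeomorphCircle_apply] at ht
    rw [ht, mul_div_cancel₀ _ (node_ne_zero _ _ _ _)]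
  have := hsub ⟨t, rfl⟩
  simp only [← hzt] at this
  refine closure_mono ?_ this
  rintro _ ⟨_, ⟨k, rfl⟩, rfl⟩
  refine ⟨k, ?_⟩
  have e : (k • (w : AddCircle (2 * ω₁))) = ((k * w : ℝ) : AddCircle (2 * ω₁)) := by
    rw [← zsmul_eq_mul]; rfl
  simp only [e, AddCircle.toCircle_apply_mk, Circle.coe_exp]
  rw [node, node, ← exp_add]
  congr 1
  push_cast
  field_simp

end

variable {L : PeriodPair} {ω₁ τ : ℝ} {κ α β γ : ℂ}

lemma weight_ne_zero (hω₁ : 0 < ω₁)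
    (hL₁ : L.ω₁ = 2 * (ω₁ : ℂ)) (hL₂ : L.ω₂ = 2 * ((τ : ℂ) * I)) (α₀ ν : ℝ)
    (hβ : β ∉ L.lattice) (hκ : κ ≠ 0) {j : ℕ} (hj : 0 < j) (m k : ℤ) :
    weight L ω₁ τ α₀ ν κ β j m (m + j * k) ≠ 0 := by
  have hω : (ω₁ : ℂ) ≠ 0 := by exact_mod_cast hω₁.ne'
  have hπ : (Real.pi : ℂ) ≠ 0 := by exact_mod_cast Real.pi_ne_zero
  have hd := weight_denom_ne_zero hω₁ hL₁ hL₂ hβ k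
  have hσ : L.weierstrassSigma β ≠ 0 := L.weierstrassSigma_eq_zero_iff.not.2 hβ
  have hn : ((nome ω₁ τ ^ (-2 * ν * (k : ℝ)) : ℝ) : ℂ) ≠ 0 := by
    rw [nome_rpow, ofReal_exp]; exact exp_ne_zero _
  rw [weight_add_mul α₀ ν hj, weight, if_pos (by simp)]
  simp only [sub_zero, Nat.cast_one, Int.ediv_one]
  refine div_ne_zero (mul_ne_zero (mul_ne_zero (mul_ne_zero two_pi_I_ne_zero ?_) (exp_ne_zero _))
    hn) hd
  rw [residueConst]
  exact mul_ne_zero (div_ne_zero (mul_ne_zero hκ hσ) (by simp [hω])) (exp_ne_zero _)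

lemma sphere_subset_closure_node {w : ℝ} (hω₁ : 0 < ω₁)
    (hL₁ : L.ω₁ = 2 * (ω₁ : ℂ)) (hL₂ : L.ω₂ = 2 * ((τ : ℂ) * I))
    (hw : ∀ N₁ N₂ : ℤ, (N₁, N₂) ≠ (0, 0) → w * (N₁ : ℝ) ≠ ω₁ * (N₂ : ℝ)) (α₀ ν : ℝ)
    (hβ : β ∉ L.lattice) (hκ : κ ≠ 0) {j : ℕ} (hj : 0 < j) (m : ℤ) :
    Metric.sphere (0 : ℂ) 1 ⊆
      closure (node ω₁ w j '' {s : ℤ | weight L ω₁ τ α₀ ν κ β j m s ≠ 0}) := by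
  refine (dense_node hω₁ hw hj m).trans (closure_mono ?_)
  rintro _ ⟨k, rfl⟩
  exact ⟨_, weight_ne_zero hω₁ hL₁ hL₂ α₀ ν hβ hκ hj m k, rfl⟩

/-- The series of `e ^ (p k) / (1 - b e ^ (r k))` over the integers converges absolutely
if `0 < p < r` and `b ≠ 0`. -/
lemma summable_exp_div_one_sub {p r : ℝ} (hp : 0 < p) (hpr : p < r) {b : ℂ} (hb : b ≠ 0) :
    Summable fun k : ℤ => Real.exp (p * k) / ‖1 - b * (Real.exp (r * k) : ℂ)‖ := by
  have hb' : 0 < ‖b‖ := norm_pos_iff.2 hb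
  have hr : 0 < r := hp.trans hpr
  have hnorm : ∀ t : ℝ, ‖b * (Real.exp t : ℂ)‖ = ‖b‖ * Real.exp t := fun t => by
    rw [norm_mul, norm_real, Real.norm_of_nonneg (Real.exp_pos t).le]
  refine Summable.of_nat_of_neg ?_ ?_
  -- For k → +∞ the exponential dominates the denominator, leaving decay exp((p - r)k); for k → -∞
  -- the denominator stays above 1/2 and exp(pk) decays.
  · refine Summable.of_norm_bounded_eventually_nat (g := fun n : ℕ => 2 / ‖b‖ *
      Real.exp (n * (p - r))) ((Real.summable_exp_nat_mul_iff.2 (by linarith)).mul_left _) ?_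
    have ht : Tendsto (fun n : ℕ => ‖b‖ * Real.exp (r * n)) atTop atTop :=
      (Real.tendsto_exp_atTop.comp
        (tendsto_natCast_atTop_atTop.const_mul_atTop hr)).const_mul_atTop hb'
    filter_upwards [ht.eventually_ge_atTop 2] with n hn
    rw [norm_div, norm_norm, Real.norm_of_nonneg (Real.exp_pos _).le]
    have h1 : ‖b‖ * Real.exp (r * n) / 2 ≤ ‖1 - b * (Real.exp (r * (n : ℤ)) : ℂ)‖ := by
      have := norm_sub_norm_le (b * (Real.exp (r * (n : ℤ)) : ℂ)) 1
      rw [norm_sub_rev, hnorm, norm_one] at this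
      simp only [Int.cast_natCast] at this ⊢
      linarith
    refine (div_le_div_of_nonneg_left (Real.exp_pos _).le (by positivity) h1).trans_eq ?_
    rw [mul_sub, Real.exp_sub, mul_comm (n : ℝ) p, mul_comm (n : ℝ) r, Int.cast_natCast]
    have := Real.exp_pos (r * n)
    field_simp
  · refine Summable.of_norm_bounded_eventually_nat (g := fun n : ℕ => 2 *
      Real.exp (n * (-p))) ((Real.summable_exp_nat_mul_iff.2 (by linarith)).mul_left _) ?_
    have ht : Tendsto (fun n : ℕ => ‖b‖ * Real.exp (-(r * n))) atTop (𝓝 (‖b‖ * 0)) :=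
      (Real.tendsto_exp_neg_atTop_nhds_zero.comp
        (tendsto_natCast_atTop_atTop.const_mul_atTop hr)).const_mul _
    rw [mul_zero] at ht
    filter_upwards [ht.eventually_le_const (show (0 : ℝ) < 1 / 2 by norm_num)] with n hn
    rw [norm_div, norm_norm, Real.norm_of_nonneg (Real.exp_pos _).le]
    have h1 : 1 / 2 ≤ ‖1 - b * (Real.exp (r * (-n : ℤ)) : ℂ)‖ := by
      have := norm_sub_norm_le 1 (b * (Real.exp (r * (-n : ℤ)) : ℂ))
      rw [hnorm, norm_one] at this
      simp only [Int.cast_neg, Int.cast_natCast, mul_neg] at this ⊢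
      linarith
    refine (div_le_div_of_nonneg_left (Real.exp_pos _).le (by norm_num) h1).trans_eq ?_
    rw [show p * ((-n : ℤ) : ℝ) = n * (-p) by push_cast; ring]
    ring

lemma summable_weight (hω₁ : 0 < ω₁) (hτ : 0 < τ) (α₀ : ℝ) {ν : ℝ} (hν : 0 < ν) (hν' : ν < 1)
    {j : ℕ} (hj : 0 < j) (m : ℤ) :
    Summable fun s : ℤ => ‖weight L ω₁ τ α₀ ν κ β j m s‖ := by
  have hj' : (j : ℤ) ≠ 0 := by exact_mod_cast hj.ne'
  have hinj : Function.Injective fun k : ℤ => m + j * k := fun k l h => by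
    simpa [hj.ne'] using h
  rw [← hinj.summable_iff (fun s hs => by
    rw [weight, if_neg, norm_zero]
    rintro ⟨k, hk⟩
    exact hs ⟨k, by simp only; linarith⟩)]
  have hπ := Real.pi_pos
  have hc : 0 < Real.pi * τ / ω₁ := by positivity
  -- These p and r are the growth rates of h^(-2νk) and h^(-2k); 0 < p < r is the condition 0 < ν <
  -- 1.
  have hs := (summable_exp_div_one_sub (p := 2 * ν * (Real.pi * τ / ω₁))
    (r := 2 * (Real.pi * τ / ω₁)) (by positivity) (by nlinarith)
    (exp_ne_zero (-(I * Real.pi * β / ω₁)))).mul_left ‖2 * Real.pi * I *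
        residueConst L ω₁ κ (-(α₀ : ℂ) - 2 * (ν : ℂ) * ((τ : ℂ) * I)) β‖
  refine hs.congr fun k => ?_
  have h1 : ‖exp (-(I * Real.pi * α₀ * k / ω₁))‖ = 1 := by
    rw [show -(I * Real.pi * α₀ * k / ω₁) = ((-(Real.pi * α₀ * k / ω₁) : ℝ) : ℂ) * I by
      push_cast; ring, norm_exp_ofReal_mul_I]
  rw [Function.comp, weight_add_mul α₀ ν hj, weight, if_pos (by simp)]
  simp only [sub_zero, Nat.cast_one, Int.ediv_one]
  generalize 2 * Real.pi * I *
    residueConst L ω₁ κ (-(α₀ : ℂ) - 2 * (ν : ℂ) * ((τ : ℂ) * I)) β = K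
  rw [norm_div, norm_mul, norm_mul, h1, mul_one, nome_rpow, nome_zpow, norm_real,
    Real.norm_of_nonneg (Real.exp_pos _).le, ← mul_div_assoc ‖K‖,
    show -(Real.pi * τ / ω₁) * (-2 * ν * k) = 2 * ν * (Real.pi * τ / ω₁) * k by ring,
    show -(Real.pi * τ / ω₁) * ((-2 * k : ℤ) : ℝ) = 2 * (Real.pi * τ / ω₁) * k by
      push_cast; ring]

end EllipticLBP
end

/-! ### Fourier inversion at the points wn and the change of exponent. -/

noncomputable section

namespace EllipticLBP

open Complex Filter Topology

variable {L : PeriodPair} {ω₁ τ : ℝ} {κ α β γ : ℂ}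

/-- Fourier inversion for the explicit Fourier coefficients of the periodic case. -/
lemma hasSum_weight_mul_node_zpow (hω₁ : 0 < ω₁) (hτ : 0 < τ)
    (hL₁ : L.ω₁ = 2 * (ω₁ : ℂ)) (hL₂ : L.ω₂ = 2 * ((τ : ℂ) * I)) {α₀ ν : ℝ}
    (hν : 0 < ν) (hν' : ν < 1) (hα : α = -(α₀ : ℂ) - 2 * (ν : ℂ) * ((τ : ℂ) * I))
    (hβ : β ∉ L.lattice) {j : ℕ} (hj : 0 < j) {m : ℤ}
    (hm : ω₁ * γ + L.weierstrassZeta ω₁ * β = I * Real.pi * m / j)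
    (hper : Function.Periodic (secondKind L κ α β γ) (2 * (ω₁ : ℂ) * (j : ℂ)))
    (w : ℝ) (n : ℤ) :
    HasSum (fun s => weight L ω₁ τ α₀ ν κ β j m s * node ω₁ w j s ^ n)
      (moment L κ α β γ w n) := by
  have hω : (ω₁ : ℂ) ≠ 0 := by exact_mod_cast hω₁.ne'
  have hj0 : (j : ℂ) ≠ 0 := by exact_mod_cast hj.ne'
  have hj1 : (0 : ℝ) < j := by exact_mod_cast hj
  have hT : 0 < 2 * ω₁ * (j : ℝ) := by positivity
  have : Fact (0 < 2 * ω₁ * (j : ℝ)) := ⟨hT⟩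
  have hp : Function.Periodic (fun x : ℝ => secondKind L κ α β γ x) (2 * ω₁ * (j : ℝ)) :=
    fun x => by simpa using hper x
  have hcont : Continuous fun x : ℝ => secondKind L κ α β γ x :=
    continuous_secondKind hτ hL₁ hL₂ hν hν' hα
  let F : C(AddCircle (2 * ω₁ * (j : ℝ)), ℂ) :=
    ⟨hp.lift, continuous_coinduced_dom.2 hcont⟩
  have hF : ∀ x : ℝ, F (x : AddCircle (2 * ω₁ * (j : ℝ))) = secondKind L κ α β γ x :=
    fun x => hp.lift_coe x
  have hcoef : ∀ s, fourierCoeff F s = weight L ω₁ τ α₀ ν κ β j m s := by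
    intro s
    rw [← fourierCoefficient_secondKind hω₁ hτ hL₁ hL₂ hν hν' hα hβ hj hm,
      fourierCoeff_eq_intervalIntegral _ _ 0, fourierCoefficient, zero_add, real_smul]
    push_cast
    congr 2
    ext x
    rw [hF, fourier_coe_apply, smul_eq_mul, mul_comm]
    congr 2
    push_cast
    ring
  have hsum : Summable (fourierCoeff F) := by
    simp only [funext hcoef]
    exact (summable_weight hω₁ hτ α₀ hν hν' hj m).of_norm
  -- Continuity and summable coefficients give convergence at every point, in particular at wn.
  have key := has_pointwise_sum_fourier_series_of_summable hsum
    ((w * n : ℝ) : AddCircle (2 * ω₁ * (j : ℝ)))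
  rw [hF] at key
  convert! key using 1
  · ext s
    rw [hcoef, fourier_coe_apply, smul_eq_mul, node, ← exp_int_mul]
    congr 2
    push_cast
    field_simp
  · rw [moment]; push_cast; rfl

lemma exists_secondKind_ne_zero (hκ : κ ≠ 0) :
    ∃ z, secondKind L κ α β γ z ≠ 0 := by
  have hc : ((L.lattice : Set ℂ) ∪ (fun z => z + β) ⁻¹' (L.lattice : Set ℂ)).Countable := by
    have h : (L.lattice : Set ℂ).Countable :=
      Set.countable_coe_iff.1 (inferInstanceAs (Countable L.lattice))
    exact h.union (h.preimage (add_left_injective β))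
  obtain ⟨u, hu⟩ := (hc.dense_compl ℝ).nonempty
  rw [Set.mem_compl_iff, Set.mem_union, not_or] at hu
  refine ⟨u - α, mul_ne_zero (mul_ne_zero hκ (div_ne_zero ?_ ?_)) (exp_ne_zero _)⟩
  · rw [sub_add_cancel]
    exact L.weierstrassSigma_eq_zero_iff.not.2 hu.2
  · rw [sub_add_cancel]
    exact L.weierstrassSigma_eq_zero_iff.not.2 hu.1

/-- At a point where f ≠ 0, periodicity forces the j-th power of the 2ω₁-multiplier to be 1. -/
lemma exists_int_of_periodic (hω₁ : 0 < ω₁) (hτ : 0 < τ)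
    (hL₁ : L.ω₁ = 2 * (ω₁ : ℂ)) (hL₂ : L.ω₂ = 2 * ((τ : ℂ) * I))
    (hκ : κ ≠ 0) {j : ℕ}
    (hper : Function.Periodic (secondKind L κ α β γ) (2 * (ω₁ : ℂ) * (j : ℂ))) :
    ∃ m : ℤ, (j : ℂ) * (ω₁ * γ + L.weierstrassZeta ω₁ * β) = I * Real.pi * m := by
  obtain ⟨z, hz⟩ := exists_secondKind_ne_zero (L := L) (α := α) (β := β) (γ := γ) hκ
  have h := secondKind_add_nat_mul (κ := κ) (α := α) (β := β) (γ := γ) hω₁ hτ hL₁ hL₂ z j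
  rw [hper z, eq_comm, mul_eq_right₀ hz, ← exp_nat_mul, exp_eq_one_iff] at h
  obtain ⟨n, hn⟩ := h
  exact ⟨n, by linear_combination hn / 2⟩

lemma secondKind_periodic (hω₁ : 0 < ω₁) (hτ : 0 < τ)
    (hL₁ : L.ω₁ = 2 * (ω₁ : ℂ)) (hL₂ : L.ω₂ = 2 * ((τ : ℂ) * I)) {j : ℕ} (hj : 0 < j) {m : ℤ}
    (hm : ω₁ * γ + L.weierstrassZeta ω₁ * β = I * Real.pi * m / j) :
    Function.Periodic (secondKind L κ α β γ) (2 * (ω₁ : ℂ) * (j : ℂ)) := by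
  have hj0 : (j : ℂ) ≠ 0 := by exact_mod_cast hj.ne'
  intro z
  rw [secondKind_add_nat_mul hω₁ hτ hL₁ hL₂, ← exp_nat_mul, hm, exp_eq_one_iff.2, one_mul]
  exact ⟨m, by field_simp⟩

lemma moment_add_exponent (w : ℝ) (χ : ℂ) (n : ℤ) :
    moment L κ α β (γ + χ) w n = exp (w * χ) ^ n * moment L κ α β γ w n := by
  rw [moment, secondKind_add_exponent, moment, mul_comm, ← exp_int_mul]
  congr 2
  ring

lemma sphere_subset_closure_image_div {ι : Type*} {x : ι → ℂ} {S : Set ι} {q : ℂ} (hq : q ≠ 0)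
    (h : Metric.sphere (0 : ℂ) 1 ⊆ closure (x '' S)) :
    Metric.sphere (0 : ℂ) (1 / ‖q‖) ⊆ closure ((fun s => x s / q) '' S) := by
  intro z hz
  have hz : ‖z‖ = 1 / ‖q‖ := by simpa using hz
  have hq' : ‖q‖ ≠ 0 := norm_ne_zero_iff.2 hq
  have h1 : z * q ∈ Metric.sphere (0 : ℂ) 1 := by
    rw [mem_sphere_zero_iff_norm, norm_mul, hz]
    field_simp
  have h2 := image_closure_subset_closure_image
    (f := fun u : ℂ => u / q) (by fun_prop) ⟨_, h h1, rfl⟩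
  rw [Set.image_image] at h2
  simpa [hq] using h2

end EllipticLBP

end

theorem proposition2
    (L : PeriodPair) (ω₁ τ : ℝ) (hω₁ : 0 < ω₁) (hτ : 0 < τ)
    (hL₁ : L.ω₁ = 2 * (ω₁ : ℂ)) (hL₂ : L.ω₂ = 2 * ((τ : ℂ) * Complex.I))
    (w : ℝ)
    (hw : ∀ N₁ N₂ : ℤ, (N₁, N₂) ≠ (0, 0) → w * (N₁ : ℝ) ≠ ω₁ * (N₂ : ℝ))
    (α₀ ν : ℝ) (hα₀ : 0 ≤ α₀) (hα₀' : α₀ < 2 * ω₁) (hν : 0 < ν) (hν' : ν < 1)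
    (α : ℂ) (hα : α = -(α₀ : ℂ) - 2 * (ν : ℂ) * ((τ : ℂ) * Complex.I))
    (β γ κ : ℂ) (hβ : β ∉ L.lattice) (hκ : κ ≠ 0)
    (hΔ : ∀ n : ℕ, EllipticLBP.toeplitzDet (EllipticLBP.moment L κ α β γ w) n ≠ 0)
    (j : ℕ) (hj : 0 < j) :
    -- the periodic case
    (Function.Periodic (EllipticLBP.secondKind L κ α β γ) (2 * (ω₁ : ℂ) * (j : ℂ)) →
      ∃ m : ℤ,
        (j : ℂ) * ((ω₁ : ℂ) * γ + L.weierstrassZeta (ω₁ : ℂ) * β)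
            = Complex.I * Real.pi * (m : ℂ) ∧
        Continuous (fun x : ℝ => EllipticLBP.secondKind L κ α β γ (x : ℂ)) ∧
        (∀ s : ℤ,
          EllipticLBP.fourierCoefficient (2 * ω₁ * (j : ℝ)) (EllipticLBP.secondKind L κ α β γ) s
            = EllipticLBP.weight L ω₁ τ α₀ ν κ β j m s) ∧
        Summable (fun s : ℤ => ‖EllipticLBP.weight L ω₁ τ α₀ ν κ β j m s‖) ∧
        Function.Injective (EllipticLBP.node ω₁ w j) ∧
        (∀ s : ℤ, EllipticLBP.node ω₁ w j s ∈ Metric.sphere (0 : ℂ) 1) ∧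
        Metric.sphere (0 : ℂ) 1 ⊆
          closure (EllipticLBP.node ω₁ w j ''
            {s : ℤ | EllipticLBP.weight L ω₁ τ α₀ ν κ β j m s ≠ 0}) ∧
        ∀ n n' : ℕ,
          HasSum
            (fun s : ℤ => EllipticLBP.weight L ω₁ τ α₀ ν κ β j m s *
              (EllipticLBP.lbp (EllipticLBP.moment L κ α β γ w) n).eval
                (EllipticLBP.node ω₁ w j s) *
              (EllipticLBP.lbpPartner (EllipticLBP.moment L κ α β γ w) n').eval
                (1 / EllipticLBP.node ω₁ w j s))
            (if n = n' then EllipticLBP.normConst (EllipticLBP.moment L κ α β γ w) n else 0)) ∧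
    -- the case of a general `γ`
    (∀ (m : ℤ) (χ q : ℂ),
      (ω₁ : ℂ) * (γ + χ) + L.weierstrassZeta (ω₁ : ℂ) * β
          = Complex.I * Real.pi * (m : ℂ) / (j : ℂ) →
      q = Complex.exp ((w : ℂ) * χ) →
        Function.Periodic (EllipticLBP.secondKind L κ α β (γ + χ)) (2 * (ω₁ : ℂ) * (j : ℂ)) ∧
        Continuous (fun x : ℝ => EllipticLBP.secondKind L κ α β (γ + χ) (x : ℂ)) ∧
        (∀ s : ℤ,
          EllipticLBP.fourierCoefficient (2 * ω₁ * (j : ℝ))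
              (EllipticLBP.secondKind L κ α β (γ + χ)) s
            = EllipticLBP.weight L ω₁ τ α₀ ν κ β j m s) ∧
        (∀ (n : ℕ) (z : ℂ),
          (EllipticLBP.lbp (EllipticLBP.moment L κ α β (γ + χ) w) n).eval z
            = q ^ n * (EllipticLBP.lbp (EllipticLBP.moment L κ α β γ w) n).eval (z / q)) ∧
        (∀ (n : ℕ) (z : ℂ),
          (EllipticLBP.lbpPartner (EllipticLBP.moment L κ α β (γ + χ) w) n).eval z
            = (q ^ n)⁻¹ *
              (EllipticLBP.lbpPartner (EllipticLBP.moment L κ α β γ w) n).eval (q * z)) ∧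
        Summable (fun s : ℤ => ‖EllipticLBP.weight L ω₁ τ α₀ ν κ β j m s‖) ∧
        Function.Injective (fun s : ℤ => EllipticLBP.node ω₁ w j s / q) ∧
        (∀ s : ℤ, EllipticLBP.node ω₁ w j s / q ∈ Metric.sphere (0 : ℂ) (1 / ‖q‖)) ∧
        Metric.sphere (0 : ℂ) (1 / ‖q‖) ⊆
          closure ((fun s : ℤ => EllipticLBP.node ω₁ w j s / q) ''
            {s : ℤ | EllipticLBP.weight L ω₁ τ α₀ ν κ β j m s ≠ 0}) ∧
        ∀ n n' : ℕ,
          HasSum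
            (fun s : ℤ => EllipticLBP.weight L ω₁ τ α₀ ν κ β j m s *
              (EllipticLBP.lbp (EllipticLBP.moment L κ α β γ w) n).eval
                (EllipticLBP.node ω₁ w j s / q) *
              (EllipticLBP.lbpPartner (EllipticLBP.moment L κ α β γ w) n').eval
                (q / EllipticLBP.node ω₁ w j s))
            (if n = n' then EllipticLBP.normConst (EllipticLBP.moment L κ α β γ w) n else 0)) := by
  constructor
  · intro hper
    obtain ⟨m, hm⟩ := EllipticLBP.exists_int_of_periodic hω₁ hτ hL₁ hL₂ hκ hper
    have hj0 : (j : ℂ) ≠ 0 := by exact_mod_cast hj.ne'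
    have hm' : (ω₁ : ℂ) * γ + L.weierstrassZeta (ω₁ : ℂ) * β
        = Complex.I * Real.pi * (m : ℂ) / (j : ℂ) := by
      rw [eq_div_iff hj0, ← hm, mul_comm]
    exact ⟨m, hm, EllipticLBP.continuous_secondKind hτ hL₁ hL₂ hν hν' hα,
      EllipticLBP.fourierCoefficient_secondKind hω₁ hτ hL₁ hL₂ hν hν' hα hβ hj hm',
      EllipticLBP.summable_weight hω₁ hτ α₀ hν hν' hj m,
      EllipticLBP.node_injective hω₁ hw hj,
      fun s => mem_sphere_zero_iff_norm.2 (EllipticLBP.norm_node ω₁ w j s),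
      EllipticLBP.sphere_subset_closure_node hω₁ hL₁ hL₂ hw α₀ ν hβ hκ hj m,
      EllipticLBP.hasSum_lbp_mul_lbpPartner (EllipticLBP.node_ne_zero ω₁ w j)
        (EllipticLBP.hasSum_weight_mul_node_zpow hω₁ hτ hL₁ hL₂ hν hν' hα hβ hj hm' hper w) hΔ⟩
  · intro m χ q hm hq
    have hq0 : q ≠ 0 := hq ▸ Complex.exp_ne_zero _
    have hper := EllipticLBP.secondKind_periodic (κ := κ) (α := α) hω₁ hτ hL₁ hL₂ hj hm
    have hd : ∀ n : ℤ, EllipticLBP.moment L κ α β (γ + χ) w n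
        = q ^ n * EllipticLBP.moment L κ α β γ w n := fun n =>
      hq ▸ EllipticLBP.moment_add_exponent w χ n
    have hP := EllipticLBP.eval_lbp_scale hq0 hd
    have hQ := EllipticLBP.eval_lbpPartner_scale hq0 hd
    refine ⟨hper, EllipticLBP.continuous_secondKind hτ hL₁ hL₂ hν hν' hα,
      EllipticLBP.fourierCoefficient_secondKind hω₁ hτ hL₁ hL₂ hν hν' hα hβ hj hm, hP, hQ,
      EllipticLBP.summable_weight hω₁ hτ α₀ hν hν' hj m,
      fun s t h => EllipticLBP.node_injective hω₁ hw hj ((div_left_inj' hq0).1 h),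
      fun s => mem_sphere_zero_iff_norm.2 ?_,
      EllipticLBP.sphere_subset_closure_image_div hq0
        (EllipticLBP.sphere_subset_closure_node hω₁ hL₁ hL₂ hw α₀ ν hβ hκ hj m),
      fun n n' => ?_⟩
    · rw [norm_div, EllipticLBP.norm_node]
    -- Biorthogonality for γ + χ, rescaled: P_n(z_s/q) and Q_{n'}(q/z_s) are q^(-n) and q^(n') times
    -- the values of the polynomials for γ + χ at z_s and 1/z_s. On the diagonal these powers
    -- cancel.
    · have key := (EllipticLBP.hasSum_lbp_mul_lbpPartner (EllipticLBP.node_ne_zero ω₁ w j)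
        (EllipticLBP.hasSum_weight_mul_node_zpow hω₁ hτ hL₁ hL₂ hν hν' hα hβ hj hm hper w)
        (fun n => by rw [EllipticLBP.toeplitzDet_scale hq0 hd]; exact hΔ n) n n').mul_left
        ((q ^ n)⁻¹ * q ^ n')
      convert! key using 1
      · ext s
        rw [hP, hQ, mul_one_div]
        field_simp
      · split_ifs with h
        · subst h
          rw [EllipticLBP.normConst_scale hq0 hd]
          field_simp
        · simp
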